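/- Let $d=2$ and let $\mathcal S^2_0$ be the space of real symmetric trace-free $2\times 2$ matrices with the operator norm; on $\mathbb R^2\times\mathcal S^2_0$ use $|(v,u)|^2=|v|^2+|u|^2$. For $r\ge 0$ let $$\mathscr K_r=\{(v,u)\in\mathbb R^2\times\mathcal S^2_0:\ u=v\otimes v-\tfrac r2\,\mathrm{Id}\},$$ and let $$\Lambda=\{(\bar v,\bar u)\in(\mathbb R^2\setminus\{0\})\times\mathcal S_0^2:\ \exists\,\bar q\in\mathbb R,\ \eta\in\mathbb R^2\setminus\{0\}\text{ with }\bar u\eta+\bar q\eta=0,\ \bar v\cdot\eta=0\}.$$ For $S\subset\mathbb R^2\times\mathcal S^2_0$ let $S^{(0)}=S$, $S^{(i+1)}=S^{(i)}\cup\{t\xi+(1-t)\xi':\ \xi,\xi'\in S^{(i)},\ \xi-\xi'\in\Lambda,\ t\in[0,1]\}$, and let $S^{lc}=\bigcup_{i\ge0}S^{(i)}$ be the lamination-convex hull of $S$. Identify $(z,\zeta)=(a+ib,c+id)\in\mathbb C\times\mathbb C$ with the pair $\left(\begin{pmatrix}a\\b\end{pmatrix},\begin{pmatrix}c&d\\d&-c\end{pmatrix}\right)$.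 For $r>0$ define $$V_r=\Big\{(a+ib,c)\in\mathbb C\times\mathbb R:\ |c|<\tfrac r2,\ \frac{\sqrt r\,|a|}{\frac r2+c}+\frac{\sqrt r\,|b|}{\frac r2-c}<1\Big\},$$ $$\mathcal V_r=\{(ze^{i\theta},ce^{2i\theta}):\ (z,c)\in V_r,\ 0<|c|<\tfrac r2,\ \theta\in\mathbb R\},\qquad \mathscr U_r=\mathcal V_r^{lc}.$$ Then for every $r>0$ the set $\mathscr U_r$ is an open subset of the convex hull $\mathscr K_r^{co}$, and the family $(\mathscr U_r)_{r>0}$ has the following two properties. **(P)** There is a continuous strictly increasing function $\Phi:[0,\infty)\to[0,\infty)$ with $\Phi(0)=0$ such that for every $r>0$ and every $\bar w\in\mathscr U_r$ there exist, with $Q=(0,1)^2$, a field $w=(v,u)\in C_c^\infty(Q;\mathbb R^2\times\mathcal S^2_0)$ and a function $q\in C_c^\infty(Q)$ with $\operatorname{div}u+\nabla q=0$ and $\operatorname{div}v=0$, such that $\bar w+w(x)\in\mathscr U_r$ for all $x\in Q$ and $$\int_Q|w(x)|^2\,dx\ \ge\ \Phi(\operatorname{dist}(\bar w,\mathscr K_r)).$$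 **(\*)** $\mathscr K_r\subset\mathscr U_{r'}$ whenever $0\le r<r'$. -/

import Mathlib

-- Matrices carry the operator norm induced by the Euclidean norm.
open scoped Matrix Matrix.Norms.L2Operator ContDiff

namespace StationaryEuler

/-- Symmetric trace-free real `d × d` matrices. -/
def S0 (d : ℕ) : Submodule ℝ (Matrix (Fin d) (Fin d) ℝ) where
  carrier := {u | uᵀ = u ∧ u.trace = 0}
  add_mem' := by
    rintro a b ⟨ha, ha'⟩ ⟨hb, hb'⟩
    exact ⟨by rw [Matrix.transpose_add, ha, hb], by rw [Matrix.trace_add, ha', hb', add_zero]⟩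
  zero_mem' := ⟨Matrix.transpose_zero, Matrix.trace_zero _ _⟩
  smul_mem' := by
    rintro c a ⟨ha, ha'⟩
    exact ⟨by rw [Matrix.transpose_smul, ha], by rw [Matrix.trace_smul, ha', smul_zero]⟩

/-- Physical space `ℝ^d` with the Euclidean norm. -/
abbrev Space (d : ℕ) : Type := EuclideanSpace ℝ (Fin d)

/-- State space: pairs `w = (v, u)` with `|w|² = |v|² + |u|²`, where `|v|` is the Euclidean norm
and `|u|` the operator norm. -/
abbrev State (d : ℕ) : Type := WithLp 2 (Space d × S0 d)

/-- The constraint set `K_r`: all `(v, u)` with `u = v ⊗ v - (r / d) Id`. -/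
def K (d : ℕ) (r : ℝ) : Set (State d) :=
  {w | (w.snd : Matrix (Fin d) (Fin d) ℝ) =
    Matrix.vecMulVec w.fst.ofLp w.fst.ofLp - (r / d) • (1 : Matrix (Fin d) (Fin d) ℝ)}

/-- The wave cone of the system `div u + ∇q = 0`, `div v = 0`. -/
def waveCone (d : ℕ) : Set (State d) :=
  {w | w.fst ≠ 0 ∧ ∃ (q : ℝ) (η : Fin d → ℝ), η ≠ 0 ∧
    (w.snd : Matrix (Fin d) (Fin d) ℝ) *ᵥ η + q • η = 0 ∧ w.fst.ofLp ⬝ᵥ η = 0}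

/-- The `i`-th stage of the construction of the lamination convex hull. -/
def lcIter {d : ℕ} (U : Set (State d)) : ℕ → Set (State d)
  | 0 => U
  | i + 1 => lcIter U i ∪
      {w | ∃ ξ ∈ lcIter U i, ∃ ξ' ∈ lcIter U i, ∃ t ∈ Set.Icc (0 : ℝ) 1,
        ξ - ξ' ∈ waveCone d ∧ w = t • ξ + (1 - t) • ξ'}

/-- The lamination convex hull with respect to the wave cone. -/
def lcHull {d : ℕ} (U : Set (State d)) : Set (State d) := ⋃ i, lcIter U i

/-- The `j`-th partial derivative of a scalar function. -/
noncomputable def pderiv {d : ℕ} (j : Fin d) (f : Space d → ℝ) (x : Space d) : ℝ :=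
  fderiv ℝ f x (EuclideanSpace.single j 1)

/-- The (smooth) field `w = (v, u)` is a subsolution with associated pressure `q`:
`div v = 0` and `div u + ∇q = 0`. -/
def IsSubsolution {d : ℕ} (w : Space d → State d) (q : Space d → ℝ) : Prop :=
  (∀ x, ∑ j, pderiv j (fun y => (w y).fst j) x = 0) ∧
  (∀ x i, ∑ j, pderiv j (fun y => ((w y).snd : Matrix (Fin d) (Fin d) ℝ) i j) x
    + pderiv i q x = 0)

/-- The open unit cube `(0,1)^d`. -/
def cube (d : ℕ) : Set (Space d) := {x | ∀ i, x i ∈ Set.Ioo (0 : ℝ) 1}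

/-- `f ∈ C_c^∞(Ω)`, with `f` extended by zero outside `Ω`. -/
def IsTestFunction {d : ℕ} {F : Type*} [NormedAddCommGroup F] [NormedSpace ℝ F]
    (Ω : Set (Space d)) (f : Space d → F) : Prop :=
  ContDiff ℝ ∞ f ∧ HasCompactSupport f ∧ tsupport f ⊆ Ω

/-- The perturbation property (P) for a family `U r`, `r > 0`, with one modulus `Φ` for the whole
family. -/
def PropertyP {d : ℕ} (U : ℝ → Set (State d)) : Prop :=
  ∃ Φ : ℝ → ℝ, ContinuousOn Φ (Set.Ici 0) ∧ StrictMonoOn Φ (Set.Ici 0) ∧ Φ 0 = 0 ∧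
    ∀ r > 0, ∀ w₀ ∈ U r, ∃ (w : Space d → State d) (q : Space d → ℝ),
      IsTestFunction (cube d) w ∧ IsTestFunction (cube d) q ∧ IsSubsolution w q ∧
      (∀ x ∈ cube d, w₀ + w x ∈ U r) ∧
      Φ (Metric.infDist w₀ (K d r)) ≤ ∫ x in cube d, ‖w x‖ ^ 2

/-- Property (*): `K_r ⊆ U_{r'}` for `r < r'`. -/
def PropertyStar {d : ℕ} (U : ℝ → Set (State d)) : Prop :=
  ∀ r r' : ℝ, 0 ≤ r → r < r' → K d r ⊆ U r'

/-- The identification of `ℂ × ℂ` with the two-dimensional state space: `z = a + ib` and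
`ζ = c + id` correspond to the vector `(a, b)` and the matrix with rows `(c, d)`, `(d, -c)`. -/
def ofComplex (z ζ : ℂ) : State 2 :=
  WithLp.toLp 2 (!₂[z.re, z.im],
    ⟨!![ζ.re, ζ.im; ζ.im, -ζ.re], by
      constructor
      · ext i j; fin_cases i <;> fin_cases j <;> rfl
      · simp [Matrix.trace_fin_two]⟩)

/-- The function `f_r(a + ib, c)`, used for `|c| < r/2` only. -/
noncomputable def f (r : ℝ) (z : ℂ) (c : ℝ) : ℝ :=
  √r * |z.re| / (r / 2 + c) + √r * |z.im| / (r / 2 - c)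

/-- The set `V_r` in the coordinates `(z, c)`, `c` real. -/
def V (r : ℝ) : Set (ℂ × ℝ) := {p | f r p.1 p.2 < 1 ∧ |p.2| < r / 2}

/-- The rotated family. -/
def rotV (r : ℝ) : Set (State 2) :=
  {w | ∃ (z : ℂ) (c θ : ℝ), (z, c) ∈ V r ∧ 0 < |c| ∧ |c| < r / 2 ∧
    w = ofComplex (z * Complex.exp (θ * Complex.I)) (c * Complex.exp (2 * θ * Complex.I))}

/-- The set `U_r`. -/
def U (r : ℝ) : Set (State 2) := lcHull (rotV r)

end StationaryEuler

/-!
In the coordinates `ofComplex`, the squared norm of a state is `|z|² + |ζ|²`, the set `K_r` is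
`{(z, z² / 2) : |z|² = r}`, and a state with `z ≠ 0` lies in the wave cone when `ζ` is a real
multiple of `z²`. In particular `K_r` lies on the sphere of squared radius `R² = r + r² / 4`, so
that `dist(w, K_r)² ≤ R² - |w|²` for `w` in the convex hull (`infDist_sq_le`).

*Geometry.* Any set that contains `K_r` and is stable under convex combinations along the wave cone
contains the rotated copies of `V_r` (`slicePoint_mem_of_mem_V`): four points of `K_r` span a
tetrahedron, and admissible splittings lead from its vertices to the rhombi making up `V_r`. Applied
to the convex hull of `K_r` this gives `U_r ⊆ K_r^{co}`. The rotated set is open because it is given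
by a rotation-invariant continuous function (`rotF`), and lamination preserves openness.

*Property (P).* Perturbations of a state `w ∈ U_r` within `U_r` reach every mean energy below `R²`
(`reaches_of_mem_U`), so that `Φ(s) = s² / 2` works. Let `T` be the set of
states of `U_r` from which every mean energy below `M` can be reached in any bounded open domain.
By `reaches_combo` the set `T` is stable under lamination: between two states that differ by an
element of the wave cone one inserts a plane wave taking exactly these two values on most of the
domain, and perturbs it further where it is constant. Since the domains are arbitrary open sets, no
covering argument is needed. For `r' < r` and `M = r' + r'² / 4` the set `T` contains `K_{r'}`,
hence the rotated copies of `V_{r'}`; letting `r'` tend to `r` and using stability under lamination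
once more gives all of `U_r`.

The plane waves are cut off at the level of potentials: a stream function for `v` and an Airy stress
function for `u` produce solutions of the linear system (`isSubsolution_field`), of mean zero when
the potentials have compact support.
-/

namespace StationaryEuler

/-! ### Complex coordinates on the planar state space -/

theorem ofComplex_fst_zero (z ζ : ℂ) : (ofComplex z ζ).fst 0 = z.re := rfl

theorem ofComplex_fst_one (z ζ : ℂ) : (ofComplex z ζ).fst 1 = z.im := rfl

theorem ofComplex_snd (z ζ : ℂ) : ((ofComplex z ζ).snd : Matrix (Fin 2) (Fin 2) ℝ) =
    !![ζ.re, ζ.im; ζ.im, -ζ.re] := rfl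

theorem state_ext {w w' : State 2} (h0 : w.fst 0 = w'.fst 0) (h1 : w.fst 1 = w'.fst 1)
    (h : (w.snd : Matrix (Fin 2) (Fin 2) ℝ) = w'.snd) : w = w' := by
  apply WithLp.ofLp_injective
  apply Prod.ext
  · ext i
    fin_cases i
    · exact h0
    · exact h1
  · exact Subtype.ext h

theorem ofComplex_add (z ζ z' ζ' : ℂ) :
    ofComplex (z + z') (ζ + ζ') = ofComplex z ζ + ofComplex z' ζ' := by
  refine state_ext rfl rfl ?_
  rw [WithLp.add_snd, Submodule.coe_add]
  simp only [ofComplex_snd]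
  ext i j; fin_cases i <;> fin_cases j <;> simp [add_comm]

theorem ofComplex_smul (t : ℝ) (z ζ : ℂ) :
    ofComplex (t • z) (t • ζ) = t • ofComplex z ζ := by
  refine state_ext ?_ ?_ ?_
  · change (t • z).re = t * z.re
    simp
  · change (t • z).im = t * z.im
    simp
  change _ = t • ((ofComplex z ζ).snd : Matrix (Fin 2) (Fin 2) ℝ)
  simp only [ofComplex_snd]
  ext i j; fin_cases i <;> fin_cases j <;> simp

/-- The identification of `ℂ × ℂ` with the state space as a continuous linear map. -/
noncomputable def ofComplexL : ℂ × ℂ →L[ℝ] State 2 :=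
  LinearMap.toContinuousLinearMap
    { toFun := fun p => ofComplex p.1 p.2
      map_add' := fun _ _ => ofComplex_add _ _ _ _
      map_smul' := fun t _ => ofComplex_smul t _ _ }

theorem ofComplexL_apply (p : ℂ × ℂ) : ofComplexL p = ofComplex p.1 p.2 := rfl

theorem ofComplex_sub (z ζ z' ζ' : ℂ) :
    ofComplex (z - z') (ζ - ζ') = ofComplex z ζ - ofComplex z' ζ' :=
  ofComplexL.map_sub (z, ζ) (z', ζ')

theorem ofComplex_zero : ofComplex 0 0 = 0 := ofComplexL.map_zero

/-- The vector part of a state as a complex number. -/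
noncomputable def vecPart (w : State 2) : ℂ := ⟨w.fst 0, w.fst 1⟩

/-- The matrix part of a state as a complex number. -/
noncomputable def matPart (w : State 2) : ℂ :=
  ⟨(w.snd : Matrix (Fin 2) (Fin 2) ℝ) 0 0, (w.snd : Matrix (Fin 2) (Fin 2) ℝ) 0 1⟩

theorem ofComplex_vecPart_matPart (w : State 2) : ofComplex (vecPart w) (matPart w) = w := by
  refine state_ext rfl rfl ?_
  rw [ofComplex_snd]
  obtain ⟨hs, ht⟩ := w.snd.2
  rw [Matrix.trace_fin_two] at ht
  have h10 := congrFun (congrFun hs 0) 1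
  rw [Matrix.transpose_apply] at h10
  ext i j; fin_cases i <;> fin_cases j
  · rfl
  · rfl
  · simpa [matPart] using h10.symm
  · simp only [matPart, Fin.mk_one, Fin.isValue, Matrix.of_apply, Matrix.cons_val',
      Matrix.cons_val_one, Matrix.cons_val_fin_one]
    linarith

theorem exists_ofComplex (w : State 2) : ∃ z ζ, ofComplex z ζ = w :=
  ⟨_, _, ofComplex_vecPart_matPart w⟩

theorem vecPart_ofComplex (z ζ : ℂ) : vecPart (ofComplex z ζ) = z := rfl

theorem matPart_ofComplex (z ζ : ℂ) : matPart (ofComplex z ζ) = ζ := rfl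

/-- The operator norm of a symmetric trace-free `2 × 2` matrix is its Euclidean length as a complex
number, because its square is a multiple of the identity. -/
theorem norm_ofComplex_sq (z ζ : ℂ) :
    ‖ofComplex z ζ‖ ^ 2 = z.re ^ 2 + z.im ^ 2 + ζ.re ^ 2 + ζ.im ^ 2 := by
  have h1 : ‖(ofComplex z ζ).fst‖ ^ 2 = z.re ^ 2 + z.im ^ 2 := by
    rw [EuclideanSpace.norm_sq_eq, Fin.sum_univ_two, ofComplex_fst_zero, ofComplex_fst_one]
    simp
  have h2 : ‖(ofComplex z ζ).snd‖ ^ 2 = ζ.re ^ 2 + ζ.im ^ 2 := by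
    change ‖((ofComplex z ζ).snd : Matrix (Fin 2) (Fin 2) ℝ)‖ ^ 2 = _
    rw [sq, ← Matrix.l2_opNorm_conjTranspose_mul_self, ofComplex_snd]
    have : (!![ζ.re, ζ.im; ζ.im, -ζ.re] : Matrix (Fin 2) (Fin 2) ℝ)ᴴ *
        !![ζ.re, ζ.im; ζ.im, -ζ.re] = (ζ.re ^ 2 + ζ.im ^ 2) • 1 := by
      ext i j; fin_cases i <;> fin_cases j <;>
        simp [Matrix.mul_apply, Fin.sum_univ_two] <;> ring
    rw [this, norm_smul, norm_one, mul_one, Real.norm_of_nonneg (by positivity)]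
  rw [WithLp.prod_norm_sq_eq_of_L2]
  rw [h1, h2]; ring

theorem ofComplex_mem_K {r : ℝ} {z ζ : ℂ} :
    ofComplex z ζ ∈ K 2 r ↔ ζ = z ^ 2 / 2 ∧ z.re ^ 2 + z.im ^ 2 = r := by
  have h : ofComplex z ζ ∈ K 2 r ↔ !![ζ.re, ζ.im; ζ.im, -ζ.re] =
    Matrix.vecMulVec ![z.re, z.im] ![z.re, z.im] - (r / (2 : ℕ)) • (1 : Matrix (Fin 2) (Fin 2) ℝ) :=
    Iff.rfl
  have h' : ζ = z ^ 2 / 2 ↔ ζ.re = (z.re ^ 2 - z.im ^ 2) / 2 ∧ ζ.im = z.re * z.im := by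
    rw [Complex.ext_iff]
    simp [sq]
    intro _
    constructor <;> intro h <;> linarith
  rw [h, h', ← Matrix.ext_iff]
  simp only [Fin.forall_fin_two]
  simp
  constructor
  · rintro ⟨⟨h1, h2⟩, h3, h4⟩
    refine ⟨⟨?_, ?_⟩, ?_⟩ <;> nlinarith
  · rintro ⟨⟨h1, h2⟩, h3⟩
    refine ⟨⟨?_, ?_⟩, ?_, ?_⟩ <;> nlinarith

theorem norm_sq_of_mem_K {r : ℝ} {w : State 2} (hw : w ∈ K 2 r) : ‖w‖ ^ 2 = r + r ^ 2 / 4 := by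
  obtain ⟨z, ζ, rfl⟩ := exists_ofComplex w
  obtain ⟨rfl, hr⟩ := ofComplex_mem_K.1 hw
  have h1 : (z ^ 2 / 2).re = (z.re ^ 2 - z.im ^ 2) / 2 := by simp [sq]
  have h2 : (z ^ 2 / 2).im = z.re * z.im := by simp [sq]; ring
  rw [norm_ofComplex_sq, h1, h2, ← hr]
  ring

/-- A state lies in the wave cone when its matrix part is a real multiple of the square of its
nonzero vector part. -/
theorem ofComplex_mem_waveCone {z : ℂ} (hz : z ≠ 0) (l : ℝ) :
    ofComplex z (l * z ^ 2) ∈ waveCone 2 := by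
  refine ⟨?_, l * (z.re ^ 2 + z.im ^ 2), ![-z.im, z.re], ?_, ?_, ?_⟩
  · intro h
    apply hz
    apply Complex.ext
    · exact congrArg (fun v : Space 2 => v 0) h
    · exact congrArg (fun v : Space 2 => v 1) h
  · intro h
    apply hz
    apply Complex.ext
    · exact congrFun h 1
    · simpa using congrFun h 0
  · rw [ofComplex_snd]
    ext i; fin_cases i <;> simp [sq] <;> ring
  · rw [dotProduct, Fin.sum_univ_two]
    change z.re * -z.im + z.im * z.re = 0
    ring

/-- Directions of the wave cone come with a wave vector `η`, in terms of which both parts are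
explicit. -/
theorem exists_of_mem_waveCone {w : State 2} (hw : w ∈ waveCone 2) :
    ∃ (η : Space 2) (α β : ℝ), η ≠ 0 ∧
      w = ofComplex ⟨α * η 1, -(α * η 0)⟩
        ⟨β * ((η 1 ^ 2 - η 0 ^ 2) / 2), -(β * (η 0 * η 1))⟩ := by
  obtain ⟨z, ζ, rfl⟩ := exists_ofComplex w
  obtain ⟨-, q, η, hη, h1, h2⟩ := hw
  rw [ofComplex_snd] at h1
  have e0 := congrFun h1 0
  have e1 := congrFun h1 1
  simp [dotProduct, Fin.sum_univ_two] at e0 e1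
  have e2 : z.re * η 0 + z.im * η 1 = 0 := by
    rw [dotProduct, Fin.sum_univ_two] at h2
    exact h2
  have hpos : 0 < η 0 ^ 2 + η 1 ^ 2 := by
    by_contra! h
    apply hη
    ext i; fin_cases i
    · change η 0 = 0; nlinarith [sq_nonneg (η 0), sq_nonneg (η 1)]
    · change η 1 = 0; nlinarith [sq_nonneg (η 0), sq_nonneg (η 1)]
  have e3 : 2 * ζ.re * (η 0 * η 1) + ζ.im * (η 1 ^ 2 - η 0 ^ 2) = 0 := by
    linear_combination η 1 * e0 - η 0 * e1
  set n := η 0 ^ 2 + η 1 ^ 2 with hn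
  refine ⟨WithLp.toLp 2 η, (z.re * η 1 - z.im * η 0) / n,
    2 * (ζ.re * (η 1 ^ 2 - η 0 ^ 2) - 2 * ζ.im * (η 0 * η 1)) / n ^ 2, ?_, ?_⟩
  · intro h; apply hη
    exact congrArg WithLp.ofLp h
  · congr 1
    · apply Complex.ext
      · change z.re = (z.re * η 1 - z.im * η 0) / n * η 1
        field_simp
        rw [hn]; linear_combination η 0 * e2
      · change z.im = -((z.re * η 1 - z.im * η 0) / n * η 0)
        field_simp
        rw [hn]; linear_combination η 1 * e2
    · apply Complex.ext
      · change ζ.re = 2 * (ζ.re * (η 1 ^ 2 - η 0 ^ 2) - 2 * ζ.im * (η 0 * η 1)) / n ^ 2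
          * ((η 1 ^ 2 - η 0 ^ 2) / 2)
        field_simp
        rw [hn]; linear_combination 2 * (η 0 * η 1) * e3
      · change ζ.im = -(2 * (ζ.re * (η 1 ^ 2 - η 0 ^ 2) - 2 * ζ.im * (η 0 * η 1)) / n ^ 2
          * (η 0 * η 1))
        field_simp
        rw [hn]; linear_combination (η 1 ^ 2 - η 0 ^ 2) * e3

/-! ### Lamination convexity and the rotated tetrahedra -/

/-- Stability under convex combinations along directions of the wave cone. -/
def LamConvex {d : ℕ} (T : Set (State d)) : Prop :=
  ∀ ξ ∈ T, ∀ ξ' ∈ T, ξ - ξ' ∈ waveCone d → ∀ t ∈ Set.Icc (0 : ℝ) 1, t • ξ + (1 - t) • ξ' ∈ T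

theorem lcIter_mono {d : ℕ} (U : Set (State d)) : Monotone (lcIter U) :=
  monotone_nat_of_le_succ fun _ => Set.subset_union_left

theorem subset_lcHull {d : ℕ} (U : Set (State d)) : U ⊆ lcHull U :=
  Set.subset_iUnion (lcIter U) 0

theorem lamConvex_lcHull {d : ℕ} (U : Set (State d)) : LamConvex (lcHull U) := by
  intro ξ hξ ξ' hξ' h t ht
  obtain ⟨i, hi⟩ := Set.mem_iUnion.1 hξ
  obtain ⟨j, hj⟩ := Set.mem_iUnion.1 hξ'
  exact Set.mem_iUnion.2 ⟨max i j + 1, Or.inr ⟨ξ, lcIter_mono U (le_max_left i j) hi, ξ',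
    lcIter_mono U (le_max_right i j) hj, t, ht, h, rfl⟩⟩

theorem lcHull_subset {d : ℕ} {U T : Set (State d)} (hU : U ⊆ T) (hT : LamConvex T) :
    lcHull U ⊆ T := by
  refine Set.iUnion_subset fun i => ?_
  induction i with
  | zero => exact hU
  | succ i ih =>
    rintro w (hw | ⟨ξ, hξ, ξ', hξ', t, ht, h, rfl⟩)
    · exact ih hw
    · exact hT ξ (ih hξ) ξ' (ih hξ') h t ht

theorem lamConvex_of_convex {d : ℕ} {T : Set (State d)} (hT : Convex ℝ T) : LamConvex T :=
  fun _ hξ _ hξ' _ _ ht => hT hξ hξ' ht.1 (sub_nonneg.2 ht.2) (add_sub_cancel _ _)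

/-- Translating both end points of a segment keeps its direction, so lamination steps preserve
openness. -/
theorem isOpen_lcHull {d : ℕ} {U : Set (State d)} (hU : IsOpen U) : IsOpen (lcHull U) := by
  refine isOpen_iUnion fun i => ?_
  induction i with
  | zero => exact hU
  | succ i ih =>
    refine ih.union (isOpen_iff_mem_nhds.2 ?_)
    rintro _ ⟨ξ, hξ, ξ', hξ', t, ht, h, rfl⟩
    set w := t • ξ + (1 - t) • ξ' with hw
    have h1 : ∀ᶠ y in nhds w, ξ + (y - w) ∈ lcIter U i := by
      have : Filter.Tendsto (fun y => ξ + (y - w)) (nhds w) (nhds ξ) := by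
        have : Continuous fun y => ξ + (y - w) := by fun_prop
        simpa using this.tendsto w
      exact this.eventually_mem (ih.mem_nhds hξ)
    have h2 : ∀ᶠ y in nhds w, ξ' + (y - w) ∈ lcIter U i := by
      have : Filter.Tendsto (fun y => ξ' + (y - w)) (nhds w) (nhds ξ') := by
        have : Continuous fun y => ξ' + (y - w) := by fun_prop
        simpa using this.tendsto w
      exact this.eventually_mem (ih.mem_nhds hξ')
    filter_upwards [h1, h2] with y hy1 hy2
    refine ⟨_, hy1, _, hy2, t, ht, by simpa using h, ?_⟩
    have : y = w + (y - w) := by abel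
    rw [hw] at this
    conv_lhs => rw [this]
    rw [hw]
    module

/-- The point with coordinates `(x, y, c)` of the three-dimensional slice of real `ζ`, rotated by
the unit complex number `u`. -/
noncomputable def slicePoint (u : ℂ) (x y c : ℝ) : State 2 :=
  ofComplex (⟨x, y⟩ * u) (c * u ^ 2)

theorem slicePoint_combo (u : ℂ) (x y c x' y' c' t : ℝ) :
    t • slicePoint u x y c + (1 - t) • slicePoint u x' y' c' =
      slicePoint u (t * x + (1 - t) * x') (t * y + (1 - t) * y') (t * c + (1 - t) * c') := by
  rw [slicePoint, slicePoint, slicePoint, ← ofComplex_smul, ← ofComplex_smul, ← ofComplex_add]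
  congr 1
  · rw [← smul_mul_assoc, ← smul_mul_assoc, ← add_mul]
    congr 1
    apply Complex.ext <;> simp
  · push_cast
    simp only [Complex.real_smul]
    push_cast
    ring

/-- The admissible directions inside a slice: the increment of `c` has to be a real multiple of the
square of the increment of `x + iy`, which is therefore real or imaginary unless `c` is kept. -/
theorem slicePoint_mem {T : Set (State 2)} (hT : LamConvex T) {u : ℂ} (hu : u ≠ 0)
    {x y c x' y' c' : ℝ} (h : slicePoint u x y c ∈ T) (h' : slicePoint u x' y' c' ∈ T) {t : ℝ}
    (ht : t ∈ Set.Icc (0 : ℝ) 1) (hne : x ≠ x' ∨ y ≠ y')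
    (l : ℝ) (hc1 : c - c' = l * ((x - x') ^ 2 - (y - y') ^ 2)) (hc2 : l * (x - x') * (y - y') = 0) :
    slicePoint u (t * x + (1 - t) * x') (t * y + (1 - t) * y') (t * c + (1 - t) * c') ∈ T := by
  rw [← slicePoint_combo]
  refine hT _ h _ h' ?_ t ht
  rw [slicePoint, slicePoint, ← ofComplex_sub, ← sub_mul]
  have h1 : ((⟨x, y⟩ : ℂ) - ⟨x', y'⟩) ≠ 0 := by
    rw [sub_ne_zero]
    intro he
    obtain ⟨h1, h2⟩ := Complex.ext_iff.1 he
    simp only at h1 h2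
    tauto
  have h2 : (c : ℂ) * u ^ 2 - c' * u ^ 2 = l * (((⟨x, y⟩ : ℂ) - ⟨x', y'⟩) * u) ^ 2 := by
    have : ((c - c' : ℝ) : ℂ) = l * ((⟨x, y⟩ : ℂ) - ⟨x', y'⟩) ^ 2 := by
      apply Complex.ext
      · simp [sq]; linarith
      · simp only [sq, Complex.mul_im, Complex.sub_re, Complex.sub_im, Complex.ofReal_re,
          Complex.ofReal_im]
        linear_combination (-2) * hc2
    rw [mul_pow, ← mul_assoc, ← this]
    push_cast
    ring
  rw [h2]
  exact ofComplex_mem_waveCone (mul_ne_zero h1 hu) l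

/-- Splitting along the wave cone leads from the vertices `(±√r, 0, r/2)`, `(0, ±√r, -r/2)` of a
tetrahedron first to the two midpoints `(0, 0, ±r/2)`, then to the vertices of the rhombus at each
height `c`, and finally to all of that rhombus, since every horizontal direction is admissible. -/
theorem slicePoint_mem_of_mem_V {T : Set (State 2)} (hT : LamConvex T) {r : ℝ} (hr : 0 < r)
    (hK : K 2 r ⊆ T) {u : ℂ} (hu : u.re ^ 2 + u.im ^ 2 = 1) {z : ℂ} {c : ℝ} (hV : (z, c) ∈ V r) :
    slicePoint u z.re z.im c ∈ T := by
  have hu0 : u ≠ 0 := by rintro rfl; simp at hu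
  set s := √r with hs
  have hs0 : 0 < s := Real.sqrt_pos.2 hr
  have hs2 : s ^ 2 = r := Real.sq_sqrt hr.le
  have mem (x y : ℝ) (c : ℝ) (hxy : x ^ 2 + y ^ 2 = r) (hc : 2 * c = x ^ 2 - y ^ 2)
      (h0 : x * y = 0) : slicePoint u x y c ∈ T := by
    apply hK
    refine ofComplex_mem_K.2 ⟨?_, ?_⟩
    · have : (c : ℂ) = (⟨x, y⟩ : ℂ) ^ 2 / 2 := by
        apply Complex.ext
        · simp [sq]; linarith
        · simp [sq]; linarith
      rw [this]; ring
    · simp only [Complex.mul_re, Complex.mul_im]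
      linear_combination (x ^ 2 + y ^ 2) * hu + hxy
  have v1 : slicePoint u s 0 (r / 2) ∈ T := mem _ _ _ (by simp [hs2]) (by rw [hs2]; ring) (by simp)
  have v2 : slicePoint u (-s) 0 (r / 2) ∈ T :=
    mem _ _ _ (by simp [hs2]) (by rw [neg_sq, hs2]; ring) (by simp)
  have v3 : slicePoint u 0 s (-(r / 2)) ∈ T :=
    mem _ _ _ (by simp [hs2]) (by rw [hs2]; ring) (by simp)
  have v4 : slicePoint u 0 (-s) (-(r / 2)) ∈ T :=
    mem _ _ _ (by simp [hs2]) (by rw [neg_sq, hs2]; ring) (by simp)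
  have half : (1 / 2 : ℝ) ∈ Set.Icc (0 : ℝ) 1 := by constructor <;> norm_num
  have m1 : slicePoint u 0 0 (r / 2) ∈ T := by
    have := slicePoint_mem hT hu0 v1 v2 half (Or.inl (by linarith)) 0 (by ring) (by ring)
    convert this using 1
    congr 1 <;> ring
  have m2 : slicePoint u 0 0 (-(r / 2)) ∈ T := by
    have := slicePoint_mem hT hu0 v3 v4 half (Or.inr (by linarith)) 0 (by ring) (by ring)
    convert this using 1
    congr 1 <;> ring
  obtain ⟨hf, hc⟩ := hV
  obtain ⟨hc1, hc2⟩ := abs_lt.1 hc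
  simp only [f] at hf hc1 hc2
  rw [← hs] at hf
  have hτ : 1 / 2 + c / r ∈ Set.Icc (0 : ℝ) 1 := by
    constructor
    · have : 1 / 2 + c / r = (r / 2 + c) / r := by field_simp
      rw [this]; exact div_nonneg (by linarith) hr.le
    · have : 1 / 2 + c / r = 1 - (r / 2 - c) / r := by field_simp; ring
      rw [this]; linarith [div_nonneg (by linarith : 0 ≤ r / 2 - c) hr.le]
  have hcr : c / r * r = c := div_mul_cancel₀ _ hr.ne'
  set A := (1 / 2 + c / r) * s with hA
  set B := (1 / 2 - c / r) * s with hB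
  have hA' : s * A = r / 2 + c := by rw [hA]; linear_combination (1 / 2 + c / r) * hs2 + hcr
  have hB' : s * B = r / 2 - c := by rw [hB]; linear_combination (1 / 2 - c / r) * hs2 - hcr
  have hA0 : 0 < A := by by_contra! h; nlinarith
  have hB0 : 0 < B := by by_contra! h; nlinarith
  have e1 : slicePoint u A 0 c ∈ T := by
    have := slicePoint_mem hT hu0 v1 m2 hτ (Or.inl hs0.ne') 1
      (by linear_combination -hs2) (by ring)
    convert this using 1
    congr 1
    · rw [hA]; ring
    · ring
    · linear_combination -hcr
  have e2 : slicePoint u (-A) 0 c ∈ T := by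
    have := slicePoint_mem hT hu0 v2 m2 hτ (Or.inl (by linarith)) 1
      (by linear_combination -hs2) (by ring)
    convert this using 1
    congr 1
    · rw [hA]; ring
    · ring
    · linear_combination -hcr
  have e3 : slicePoint u 0 B c ∈ T := by
    have := slicePoint_mem hT hu0 m1 v3 hτ (Or.inr hs0.ne) (-1)
      (by linear_combination -hs2) (by ring)
    convert this using 1
    congr 1
    · ring
    · rw [hB]; ring
    · linear_combination -hcr
  have e4 : slicePoint u 0 (-B) c ∈ T := by
    have := slicePoint_mem hT hu0 m1 v4 hτ (Or.inr (by linarith)) (-1)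
      (by linear_combination -hs2) (by ring)
    convert this using 1
    congr 1
    · ring
    · rw [hB]; ring
    · linear_combination -hcr
  have axA (x : ℝ) (hx : |x| ≤ A) : slicePoint u x 0 c ∈ T := by
    obtain ⟨h1, h2⟩ := abs_le.1 hx
    have ht : (x + A) / (2 * A) ∈ Set.Icc (0 : ℝ) 1 := by
      constructor
      · exact div_nonneg (by linarith) (by linarith)
      · rw [div_le_one (by linarith)]; linarith
    have := slicePoint_mem hT hu0 e1 e2 ht (Or.inl (by linarith)) 0 (by ring) (by ring)
    convert this using 1
    congr 1
    · field_simp; ring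
    · ring
    · ring
  have axB (x : ℝ) (hx : |x| ≤ B) : slicePoint u 0 x c ∈ T := by
    obtain ⟨h1, h2⟩ := abs_le.1 hx
    have ht : (x + B) / (2 * B) ∈ Set.Icc (0 : ℝ) 1 := by
      constructor
      · exact div_nonneg (by linarith) (by linarith)
      · rw [div_le_one (by linarith)]; linarith
    have := slicePoint_mem hT hu0 e3 e4 ht (Or.inr (by linarith)) 0 (by ring) (by ring)
    convert this using 1
    congr 1
    · ring
    · field_simp; ring
    · ring
  rw [← hA', ← hB', mul_div_mul_left _ _ hs0.ne', mul_div_mul_left _ _ hs0.ne'] at hf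
  have p1 : 0 ≤ |z.re| / A := by positivity
  have p2 : 0 ≤ |z.im| / B := by positivity
  by_cases hz : z.re = 0 ∧ z.im = 0
  · rw [hz.1, hz.2]
    exact axA 0 (by simpa using hA0.le)
  -- the weight `α` splits the slack of the inequality `|a| / A + |b| / B < 1` evenly
  set α := (|z.re| / A + (1 - |z.im| / B)) / 2 with hα
  have a1 : |z.re| / A < α := by linarith
  have a2 : |z.im| / B < 1 - α := by linarith
  have a0 : 0 < α := by linarith
  have a0' : 0 < 1 - α := by linarith
  have q1 : slicePoint u (z.re / α) 0 c ∈ T := by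
    apply axA
    rw [abs_div, abs_of_pos a0, div_le_iff₀ a0]
    rw [div_lt_iff₀ hA0] at a1
    linarith
  have q2 : slicePoint u 0 (z.im / (1 - α)) c ∈ T := by
    apply axB
    rw [abs_div, abs_of_pos a0', div_le_iff₀ a0']
    rw [div_lt_iff₀ hB0] at a2
    linarith
  have := slicePoint_mem hT hu0 q1 q2 (t := α) ⟨a0.le, by linarith⟩
    (by
      by_contra! h
      apply hz
      constructor
      · simpa [a0.ne'] using h.1
      · simpa [a0'.ne'] using h.2.symm) 0 (by ring) (by ring)
  convert this using 1
  congr 1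
  · field_simp; ring
  · field_simp; ring
  · ring

theorem rotV_subset {T : Set (State 2)} (hT : LamConvex T) {r : ℝ} (hr : 0 < r)
    (hK : K 2 r ⊆ T) : rotV r ⊆ T := by
  rintro _ ⟨z, c, θ, hV, -, -, rfl⟩
  have h1 : (Complex.exp (θ * Complex.I)).re ^ 2 + (Complex.exp (θ * Complex.I)).im ^ 2 = 1 := by
    rw [Complex.exp_ofReal_mul_I_re, Complex.exp_ofReal_mul_I_im, Real.cos_sq_add_sin_sq]
  have h2 : Complex.exp (2 * θ * Complex.I) = Complex.exp (θ * Complex.I) ^ 2 := by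
    rw [← Complex.exp_nat_mul]
    congr 1; push_cast; ring
  rw [h2]
  exact slicePoint_mem_of_mem_V hT hr hK h1 hV

theorem U_subset_convexHull {r : ℝ} (hr : 0 < r) : U r ⊆ convexHull ℝ (K 2 r) :=
  lcHull_subset (rotV_subset (lamConvex_of_convex (convex_convexHull ℝ _)) hr
    (subset_convexHull ℝ _)) (lamConvex_of_convex (convex_convexHull ℝ _))

/-! ### Openness, property (*), and the distance to the constraint set -/

theorem continuous_vecPart : Continuous vecPart := by
  have : vecPart = fun w : State 2 => ((w.fst 0 : ℝ) : ℂ) + (w.fst 1 : ℝ) * Complex.I := by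
    funext w
    apply Complex.ext <;> simp [vecPart]
  rw [this]
  have h : Continuous fun w : State 2 => w.fst := WithLp.continuous_fst 2 _ _
  have hi (i : Fin 2) : Continuous fun w : State 2 => w.fst i :=
    (EuclideanSpace.proj (𝕜 := ℝ) i).continuous.comp h
  have h0 := hi 0
  have h1 := hi 1
  fun_prop

theorem continuous_matPart : Continuous matPart := by
  have : matPart = fun w : State 2 => (((w.snd : Matrix (Fin 2) (Fin 2) ℝ) 0 0 : ℝ) : ℂ) +
      ((w.snd : Matrix (Fin 2) (Fin 2) ℝ) 0 1 : ℝ) * Complex.I := by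
    funext w
    apply Complex.ext <;> simp [matPart]
  rw [this]
  have h : Continuous fun w : State 2 => (w.snd : Matrix (Fin 2) (Fin 2) ℝ) :=
    continuous_subtype_val.comp (WithLp.continuous_snd 2 _ _)
  have hi (i j : Fin 2) : Continuous fun w : State 2 => (w.snd : Matrix (Fin 2) (Fin 2) ℝ) i j :=
    (continuous_apply_apply i j).comp h
  exact (Complex.continuous_ofReal.comp (hi 0 0)).add
    ((Complex.continuous_ofReal.comp (hi 0 1)).mul continuous_const)

/-- The function `f r` extended to all `ζ ≠ 0` by invariance under the rotations
`(z, ζ) ↦ (z e^{iθ}, ζ e^{2iθ})`. -/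
noncomputable def rotF (r : ℝ) (z ζ : ℂ) : ℝ :=
  √r * √((Complex.normSq z + (z ^ 2 * starRingEnd ℂ ζ).re / ‖ζ‖) / 2) / (r / 2 + ‖ζ‖) +
  √r * √((Complex.normSq z - (z ^ 2 * starRingEnd ℂ ζ).re / ‖ζ‖) / 2) / (r / 2 - ‖ζ‖)

theorem rotF_rotate (r : ℝ) (z : ℂ) {c : ℝ} (hc : c ≠ 0) (θ : ℝ) :
    rotF r (z * Complex.exp (θ * Complex.I)) (c * Complex.exp (2 * θ * Complex.I)) = f r z c := by
  have h2 : Complex.exp (2 * θ * Complex.I) = Complex.exp (θ * Complex.I) ^ 2 := by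
    rw [← Complex.exp_nat_mul]
    congr 1; push_cast; ring
  set u := Complex.exp (θ * Complex.I) with hu
  have hn : ‖u‖ = 1 := Complex.norm_exp_ofReal_mul_I θ
  have huu : u * starRingEnd ℂ u = 1 := by
    rw [Complex.mul_conj, Complex.normSq_eq_norm_sq, hn]; simp
  have e1 : (z * u) ^ 2 * starRingEnd ℂ (c * u ^ 2) = c * z ^ 2 := by
    rw [map_mul, map_pow, Complex.conj_ofReal]
    linear_combination c * z ^ 2 * (u * starRingEnd ℂ u + 1) * huu
  have e2 : ‖(c : ℂ) * u ^ 2‖ = |c| := by simp [hn]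
  have e3 : Complex.normSq (z * u) = z.re ^ 2 + z.im ^ 2 := by
    rw [map_mul, Complex.normSq_eq_norm_sq u, hn, Complex.normSq_apply]; ring
  have e4 : ((c : ℂ) * z ^ 2).re = c * (z.re ^ 2 - z.im ^ 2) := by simp [sq]
  rw [rotF, f, h2, e1, e2, e3, e4]
  rcases lt_or_gt_of_ne hc with h | h
  · rw [abs_of_neg h]
    have : c * (z.re ^ 2 - z.im ^ 2) / -c = z.im ^ 2 - z.re ^ 2 := by field_simp; ring
    rw [this, show (z.re ^ 2 + z.im ^ 2 + (z.im ^ 2 - z.re ^ 2)) / 2 = z.im ^ 2 by ring,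
      show (z.re ^ 2 + z.im ^ 2 - (z.im ^ 2 - z.re ^ 2)) / 2 = z.re ^ 2 by ring,
      Real.sqrt_sq_eq_abs, Real.sqrt_sq_eq_abs, sub_neg_eq_add, ← sub_eq_add_neg, add_comm]
  · rw [abs_of_pos h]
    have : c * (z.re ^ 2 - z.im ^ 2) / c = z.re ^ 2 - z.im ^ 2 := by field_simp
    rw [this, show (z.re ^ 2 + z.im ^ 2 + (z.re ^ 2 - z.im ^ 2)) / 2 = z.re ^ 2 by ring,
      show (z.re ^ 2 + z.im ^ 2 - (z.re ^ 2 - z.im ^ 2)) / 2 = z.im ^ 2 by ring,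
      Real.sqrt_sq_eq_abs, Real.sqrt_sq_eq_abs]

theorem rotV_eq (r : ℝ) : rotV r = {w | (matPart w ≠ 0 ∧ ‖matPart w‖ < r / 2) ∧
    rotF r (vecPart w) (matPart w) < 1} := by
  ext w
  constructor
  · rintro ⟨z, c, θ, hV, hc, hcr, rfl⟩
    have hc0 : c ≠ 0 := abs_pos.1 hc
    have hn : ‖Complex.exp (2 * θ * Complex.I)‖ = 1 := by
      have := Complex.norm_exp_ofReal_mul_I (2 * θ)
      push_cast at this
      exact this
    simp only [Set.mem_ofPred_eq, matPart_ofComplex, vecPart_ofComplex, rotF_rotate r z hc0]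
    refine ⟨⟨?_, ?_⟩, hV.1⟩
    · exact mul_ne_zero (by exact_mod_cast hc0) (Complex.exp_ne_zero _)
    · rw [norm_mul, hn, Complex.norm_real, mul_one]; exact hcr
  · rintro ⟨⟨h0, h1⟩, h2⟩
    obtain ⟨z, ζ, rfl⟩ := exists_ofComplex w
    rw [vecPart_ofComplex, matPart_ofComplex] at *
    set θ := ζ.arg / 2 with hθ
    have e1 : ζ = (‖ζ‖ : ℝ) * Complex.exp (2 * θ * Complex.I) := by
      conv_lhs => rw [← Complex.norm_mul_exp_arg_mul_I ζ]
      rw [hθ]; congr 3; push_cast; ring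
    have e2 : z = z * Complex.exp (-(θ * Complex.I)) * Complex.exp (θ * Complex.I) := by
      rw [mul_assoc, ← Complex.exp_add]; simp
    have hpos : 0 < ‖ζ‖ := norm_pos_iff.2 h0
    refine ⟨z * Complex.exp (-(θ * Complex.I)), ‖ζ‖, θ, ⟨?_, ?_⟩, ?_, ?_, ?_⟩
    · rw [← rotF_rotate r _ hpos.ne' θ, ← e1, ← e2]
      exact h2
    · simpa using h1
    · simpa using h0
    · simpa using h1
    · rw [← e1, ← e2]

theorem isOpen_rotV {r : ℝ} (hr : 0 < r) : IsOpen (rotV r) := by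
  have hv := continuous_vecPart
  have hm := continuous_matPart
  rw [rotV_eq]
  have ho : IsOpen {w : State 2 | matPart w ≠ 0 ∧ ‖matPart w‖ < r / 2} :=
    (isOpen_ne_fun hm continuous_const).inter (isOpen_lt hm.norm continuous_const)
  suffices h : ContinuousOn (fun w => rotF r (vecPart w) (matPart w))
      {w : State 2 | matPart w ≠ 0 ∧ ‖matPart w‖ < r / 2} from
    h.isOpen_inter_preimage ho isOpen_Iio
  have h1 : ∀ w ∈ {w : State 2 | matPart w ≠ 0 ∧ ‖matPart w‖ < r / 2}, ‖matPart w‖ ≠ 0 :=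
    fun w hw => norm_ne_zero_iff.2 hw.1
  have h2 : ∀ w ∈ {w : State 2 | matPart w ≠ 0 ∧ ‖matPart w‖ < r / 2}, r / 2 + ‖matPart w‖ ≠ 0 :=
    fun w _ => by positivity
  have h3 : ∀ w ∈ {w : State 2 | matPart w ≠ 0 ∧ ‖matPart w‖ < r / 2}, r / 2 - ‖matPart w‖ ≠ 0 :=
    fun w hw => (sub_pos.2 hw.2).ne'
  have hq : ContinuousOn (fun w : State 2 =>
      (vecPart w ^ 2 * starRingEnd ℂ (matPart w)).re / ‖matPart w‖)
      {w : State 2 | matPart w ≠ 0 ∧ ‖matPart w‖ < r / 2} := by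
    refine ContinuousOn.div (Continuous.continuousOn ?_) hm.norm.continuousOn h1
    exact Complex.continuous_re.comp ((hv.pow 2).mul (Complex.continuous_conj.comp hm))
  have hz : Continuous fun w : State 2 => Complex.normSq (vecPart w) :=
    Complex.continuous_normSq.comp hv
  have hn : Continuous fun w : State 2 => ‖matPart w‖ := hm.norm
  unfold rotF
  refine ContinuousOn.add (ContinuousOn.div ?_ (by fun_prop) h2)
    (ContinuousOn.div ?_ (by fun_prop) h3)
  · exact continuousOn_const.mul (Real.continuous_sqrt.comp_continuousOn
      ((hz.continuousOn.add hq).div_const 2))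
  · exact continuousOn_const.mul (Real.continuous_sqrt.comp_continuousOn
      ((hz.continuousOn.sub hq).div_const 2))

theorem isOpen_U {r : ℝ} (hr : 0 < r) : IsOpen (U r) := isOpen_lcHull (isOpen_rotV hr)

theorem ofComplex_mem_rotV {r : ℝ} {z : ℂ} {c : ℝ} (h : f r z c < 1) (hc : c ≠ 0)
    (hcr : |c| < r / 2) : ofComplex z c ∈ rotV r :=
  ⟨z, c, 0, ⟨h, hcr⟩, abs_pos.2 hc, hcr, by simp⟩

theorem zero_mem_U {r : ℝ} (hr : 0 < r) : (0 : State 2) ∈ U r := by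
  have hs0 : 0 < √r := Real.sqrt_pos.2 hr
  have hs2 : √r * √r = r := Real.mul_self_sqrt hr.le
  have h1 : ofComplex ((√r / 8 : ℝ) : ℂ) ((r / 4 : ℝ) : ℂ) ∈ U r := by
    apply subset_lcHull
    refine ofComplex_mem_rotV ?_ (by positivity) (by rw [abs_of_pos (by positivity)]; linarith)
    simp only [f, Complex.ofReal_re, Complex.ofReal_im]
    rw [abs_of_pos (by positivity), abs_zero, mul_zero, zero_div, add_zero,
      div_lt_one (by positivity)]
    nlinarith
  have h2 : ofComplex ((-(√r / 8) : ℝ) : ℂ) ((-(r / 4) : ℝ) : ℂ) ∈ U r := by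
    apply subset_lcHull
    refine ofComplex_mem_rotV ?_ (by linarith [hr] : (-(r / 4)) < 0).ne
      (by rw [abs_neg, abs_of_pos (by positivity)]; linarith)
    simp only [f, Complex.ofReal_re, Complex.ofReal_im]
    rw [abs_neg, abs_of_pos (by positivity), abs_zero, mul_zero, zero_div, add_zero,
      div_lt_one (by linarith)]
    nlinarith
  have h3 : (1 / 2 : ℝ) • ofComplex ((√r / 8 : ℝ) : ℂ) ((r / 4 : ℝ) : ℂ) +
      (1 - 1 / 2 : ℝ) • ofComplex ((-(√r / 8) : ℝ) : ℂ) ((-(r / 4) : ℝ) : ℂ) ∈ U r :=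
    lamConvex_lcHull (rotV r) _ h1 _ h2 ?_ (1 / 2) (by constructor <;> norm_num)
  · convert h3 using 1
    rw [← ofComplex_smul, ← ofComplex_smul, ← ofComplex_add, ← ofComplex_zero]
    congr 1
    · simp only [Complex.real_smul]; push_cast; ring
    · simp only [Complex.real_smul]; push_cast; ring
  · rw [← ofComplex_sub]
    have hz : ((√r / 8 : ℝ) : ℂ) - ((-(√r / 8) : ℝ) : ℂ) ≠ 0 := by
      rw [← Complex.ofReal_sub]
      exact_mod_cast (by linarith : (0 : ℝ) < √r / 8 - -(√r / 8)).ne'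
    convert ofComplex_mem_waveCone hz 8 using 2
    have h : r / 4 - -(r / 4) = 8 * (√r / 8 - -(√r / 8)) ^ 2 := by nlinarith
    rw [← Complex.ofReal_sub, ← Complex.ofReal_sub]
    exact_mod_cast congrArg ((↑) : ℝ → ℂ) h

theorem K_subset_U {r r' : ℝ} (hr : 0 ≤ r) (h : r < r') : K 2 r ⊆ U r' := by
  intro w hw
  obtain ⟨z, ζ, rfl⟩ := exists_ofComplex w
  obtain ⟨rfl, hz⟩ := ofComplex_mem_K.1 hw
  rcases hr.eq_or_lt with rfl | hr
  · have : z = 0 := by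
      apply Complex.ext
      · change z.re = 0; nlinarith [sq_nonneg z.re, sq_nonneg z.im]
      · change z.im = 0; nlinarith [sq_nonneg z.re, sq_nonneg z.im]
    subst this
    convert zero_mem_U h using 1
    rw [← ofComplex_zero]; simp
  apply subset_lcHull
  have hn : ‖z‖ = √r := by
    rw [← hz, Complex.norm_def, Complex.normSq_apply]; congr 1; ring
  have hs0 : 0 < √r := Real.sqrt_pos.2 hr
  have hs2 : √r * √r = r := Real.mul_self_sqrt hr.le
  have hs2' : √r' * √r' = r' := Real.mul_self_sqrt (hr.trans h).le
  have hlt : √r < √r' := Real.sqrt_lt_sqrt hr.le h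
  refine ⟨(√r : ℝ), r / 2, z.arg, ⟨?_, ?_⟩, ?_, ?_, ?_⟩
  · simp only [f, Complex.ofReal_re, Complex.ofReal_im]
    rw [abs_of_pos hs0, abs_zero, mul_zero, zero_div, add_zero,
      div_lt_one (by linarith)]
    nlinarith
  · change |r / 2| < r' / 2
    rw [abs_of_pos (by positivity)]; linarith
  · rw [abs_of_pos (by positivity)]; linarith
  · rw [abs_of_pos (by positivity)]; linarith
  · have e : z = (√r : ℝ) * Complex.exp (z.arg * Complex.I) := by
      rw [← hn]; exact (Complex.norm_mul_exp_arg_mul_I z).symm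
    have h2 : Complex.exp (2 * z.arg * Complex.I) = Complex.exp (z.arg * Complex.I) ^ 2 := by
      rw [← Complex.exp_nat_mul]
      congr 1; push_cast; ring
    rw [← e, h2]
    congr 1
    conv_lhs => rw [e]
    rw [mul_pow, ← Complex.ofReal_pow, sq (√r), hs2]
    push_cast; ring

/-- For a point of the convex hull of `K_r`, the condition `|w - y|² ≥ d²` for all `y ∈ K_r` is a
half-space condition on `y`, as `K_r` lies on a sphere; hence it may be applied with `y = w`. -/
theorem infDist_sq_le {r : ℝ} {w : State 2} (hw : w ∈ convexHull ℝ (K 2 r)) :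
    Metric.infDist w (K 2 r) ^ 2 ≤ r + r ^ 2 / 4 - ‖w‖ ^ 2 := by
  set D := Metric.infDist w (K 2 r) with hD
  obtain ⟨z, ζ, rfl⟩ := exists_ofComplex w
  set ip : State 2 → ℝ := fun y => z.re * (vecPart y).re + z.im * (vecPart y).im +
    ζ.re * (matPart y).re + ζ.im * (matPart y).im with hip
  have hlin : IsLinearMap ℝ ip := by
    constructor
    · intro y y'
      obtain ⟨a, b, rfl⟩ := exists_ofComplex y
      obtain ⟨a', b', rfl⟩ := exists_ofComplex y'
      rw [← ofComplex_add]
      simp only [hip, vecPart_ofComplex, matPart_ofComplex, Complex.add_re, Complex.add_im]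
      ring
    · intro t y
      obtain ⟨a, b, rfl⟩ := exists_ofComplex y
      rw [← ofComplex_smul]
      simp only [hip, vecPart_ofComplex, matPart_ofComplex, Complex.smul_re, Complex.smul_im,
        smul_eq_mul]
      ring
  have hsub : K 2 r ⊆ {y | ip y ≤ (‖ofComplex z ζ‖ ^ 2 + (r + r ^ 2 / 4) - D ^ 2) / 2} := by
    intro y hy
    have h1 : D ≤ ‖ofComplex z ζ - y‖ := by
      rw [← dist_eq_norm]; exact Metric.infDist_le_dist_of_mem hy
    have h2 : D ^ 2 ≤ ‖ofComplex z ζ - y‖ ^ 2 :=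
      pow_le_pow_left₀ Metric.infDist_nonneg h1 2
    rw [Set.mem_ofPred_eq, ← norm_sq_of_mem_K hy]
    obtain ⟨a, b, rfl⟩ := exists_ofComplex y
    rw [← ofComplex_sub, norm_ofComplex_sq] at h2
    rw [norm_ofComplex_sq, norm_ofComplex_sq]
    simp only [hip, vecPart_ofComplex, matPart_ofComplex, Complex.sub_re, Complex.sub_im] at h2 ⊢
    linarith
  have h := convexHull_min hsub (convex_halfSpace_le hlin _) hw
  rw [Set.mem_ofPred_eq, norm_ofComplex_sq] at h
  rw [norm_ofComplex_sq]
  simp only [hip, vecPart_ofComplex, matPart_ofComplex] at h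
  linarith

/-! ### Fields with stream function and stress function -/

section Derivatives

variable {d : ℕ} {g h : Space d → ℝ}

theorem contDiff_pderiv (hg : ContDiff ℝ ∞ g) (j : Fin d) : ContDiff ℝ ∞ (pderiv j g) :=
  (hg.fderiv_right (m := ∞) le_rfl).clm_apply contDiff_const

theorem pderiv_add (hg : ContDiff ℝ ∞ g) (hh : ContDiff ℝ ∞ h) (j : Fin d) :
    pderiv j (g + h) = pderiv j g + pderiv j h := by
  funext x
  have h1 := hg.differentiable (by simp) x
  have h2 := hh.differentiable (by simp) x
  simp [pderiv, fderiv_add h1 h2]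

theorem pderiv_sub (hg : ContDiff ℝ ∞ g) (hh : ContDiff ℝ ∞ h) (j : Fin d) :
    pderiv j (g - h) = pderiv j g - pderiv j h := by
  funext x
  have h1 := hg.differentiable (by simp) x
  have h2 := hh.differentiable (by simp) x
  simp [pderiv, fderiv_sub h1 h2]

theorem pderiv_const_smul (c : ℝ) (j : Fin d) :
    pderiv j (c • g) = c • pderiv j g := by
  funext x
  simp [pderiv, fderiv_const_smul_field]

theorem pderiv_neg (j : Fin d) : pderiv j (-g) = -pderiv j g := by
  funext x
  simp [pderiv, fderiv_neg]

theorem pderiv_mul (hg : ContDiff ℝ ∞ g) (hh : ContDiff ℝ ∞ h) (j : Fin d) :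
    pderiv j (g * h) = g * pderiv j h + h * pderiv j g := by
  funext x
  have h1 := hg.differentiable (by simp) x
  have h2 := hh.differentiable (by simp) x
  simp [pderiv, fderiv_mul h1 h2]

theorem pderiv_comm (hg : ContDiff ℝ ∞ g) (i j : Fin d) :
    pderiv i (pderiv j g) = pderiv j (pderiv i g) := by
  funext x
  have hd : DifferentiableAt ℝ (fderiv ℝ g) x :=
    (hg.fderiv_right (m := ∞) le_rfl).differentiable (by simp) x
  have key (i j : Fin d) : pderiv i (pderiv j g) x =
      fderiv ℝ (fderiv ℝ g) x (EuclideanSpace.single i 1) (EuclideanSpace.single j 1) := by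
    unfold pderiv
    rw [fderiv_clm_apply hd (differentiableAt_const _)]
    simp
  rw [key, key]
  have hs : IsSymmSndFDerivAt ℝ g x := (hg.contDiffAt).isSymmSndFDerivAt
    (by simpa using (WithTop.coe_le_coe.2 le_top : ((2 : ℕ∞) : WithTop ℕ∞) ≤ ∞))
  exact hs _ _

theorem tsupport_pderiv_subset (j : Fin d) : tsupport (pderiv j g) ⊆ tsupport g := by
  refine (closure_minimal ?_ (isClosed_tsupport g))
  intro x hx
  apply support_fderiv_subset ℝ (f := g)
  intro h0
  apply hx
  simp [pderiv, h0]

theorem IsTestFunction.pderiv {Ω : Set (Space d)} (hg : IsTestFunction Ω g) (j : Fin d) :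
    IsTestFunction Ω (pderiv j g) :=
  ⟨contDiff_pderiv hg.1 j, hg.2.1.of_isClosed_subset (isClosed_tsupport _)
    (tsupport_pderiv_subset j), (tsupport_pderiv_subset j).trans hg.2.2⟩

theorem integral_pderiv {Ω : Set (Space d)} (hg : IsTestFunction Ω g) (j : Fin d) :
    ∫ x, pderiv j g x = 0 := by
  have hg' := hg.pderiv j
  have hi : MeasureTheory.Integrable g := hg.1.continuous.integrable_of_hasCompactSupport hg.2.1
  have hi' : MeasureTheory.Integrable (StationaryEuler.pderiv j g) :=
    hg'.1.continuous.integrable_of_hasCompactSupport hg'.2.1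
  have h := integral_bilinear_hasLineDerivAt_right_eq_neg_left_of_integrable
    (μ := (MeasureTheory.volume : MeasureTheory.Measure (Space d)))
    (f := fun _ => (1 : ℝ)) (f' := fun _ => 0) (g := g) (g' := StationaryEuler.pderiv j g)
    (v := EuclideanSpace.single j (1 : ℝ)) (B := ContinuousLinearMap.mul ℝ ℝ)
    (by simp) (by simpa using hi') (by simpa using hi)
    (fun x _ => by simpa using (hasFDerivAt_const (1 : ℝ) x).hasLineDerivAt _)
    (fun x _ => ((hg.1.differentiable (by simp) x).hasFDerivAt).hasLineDerivAt _)
  simpa using h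

end Derivatives

section TestFunctions

variable {d : ℕ} {F : Type*} [NormedAddCommGroup F] [NormedSpace ℝ F] {Ω Ω' : Set (Space d)}

theorem isTestFunction_of_forall_notMem {g : Space d → F} {C : Set (Space d)}
    (hg : ContDiff ℝ ∞ g) (hC : IsCompact C) (hCΩ : C ⊆ Ω) (h : ∀ x ∉ C, g x = 0) :
    IsTestFunction Ω g := by
  have hs : tsupport g ⊆ C := closure_minimal
    (fun x hx => by by_contra hxC; exact hx (h x hxC)) hC.isClosed
  exact ⟨hg, hC.of_isClosed_subset (isClosed_tsupport _) hs, hs.trans hCΩ⟩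

theorem IsTestFunction.mono {g : Space d → F} (hg : IsTestFunction Ω g) (h : Ω ⊆ Ω') :
    IsTestFunction Ω' g :=
  ⟨hg.1, hg.2.1, hg.2.2.trans h⟩

theorem IsTestFunction.add {g g' : Space d → F} (hg : IsTestFunction Ω g)
    (hg' : IsTestFunction Ω g') : IsTestFunction Ω (g + g') :=
  isTestFunction_of_forall_notMem (hg.1.add hg'.1) (hg.2.1.isCompact.union hg'.2.1.isCompact)
    (Set.union_subset hg.2.2 hg'.2.2) fun x hx => by
      rw [Set.mem_union, not_or] at hx
      simp [image_eq_zero_of_notMem_tsupport hx.1, image_eq_zero_of_notMem_tsupport hx.2]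

theorem isTestFunction_zero : IsTestFunction Ω (0 : Space d → F) :=
  isTestFunction_of_forall_notMem contDiff_const isCompact_empty (Set.empty_subset _)
    fun _ _ => rfl

theorem IsTestFunction.eq_zero {g : Space d → F} (hg : IsTestFunction Ω g) {x : Space d}
    (hx : x ∉ Ω) : g x = 0 :=
  image_eq_zero_of_notMem_tsupport fun h => hx (hg.2.2 h)

end TestFunctions

/-- The planar field with stream function `ψ` and Airy stress function `φ`: the vector part is the
rotated gradient of `ψ`, and the matrix part is the trace-free part of the cofactor matrix of the
Hessian of `φ`. -/
noncomputable def field (ψ φ : Space 2 → ℝ) (x : Space 2) : State 2 :=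
  ofComplex ⟨pderiv 1 ψ x, -pderiv 0 ψ x⟩
    ⟨(pderiv 1 (pderiv 1 φ) x - pderiv 0 (pderiv 0 φ) x) / 2, -pderiv 0 (pderiv 1 φ) x⟩

/-- The pressure belonging to `field ψ φ`, half the Laplacian of `φ`. -/
noncomputable def pressure (φ : Space 2 → ℝ) (x : Space 2) : ℝ :=
  (pderiv 0 (pderiv 0 φ) x + pderiv 1 (pderiv 1 φ) x) / 2

section Field

variable {ψ φ ψ' φ' : Space 2 → ℝ}

theorem field_add (hψ : ContDiff ℝ ∞ ψ) (hφ : ContDiff ℝ ∞ φ) (hψ' : ContDiff ℝ ∞ ψ')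
    (hφ' : ContDiff ℝ ∞ φ') : field (ψ + ψ') (φ + φ') = field ψ φ + field ψ' φ' := by
  funext x
  simp only [field, Pi.add_apply]
  rw [← ofComplex_add]
  simp only [pderiv_add hψ hψ', pderiv_add hφ hφ',
    pderiv_add (contDiff_pderiv hφ _) (contDiff_pderiv hφ' _), Pi.add_apply]
  congr 1
  · apply Complex.ext
    · simp
    · simp; ring
  · apply Complex.ext
    · simp; ring
    · simp [add_comm]

theorem field_zero : field 0 0 = 0 := by
  have h (j : Fin 2) : pderiv j (0 : Space 2 → ℝ) = 0 := by funext x; simp [pderiv]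
  funext x
  simp only [field, h, Pi.zero_apply]
  rw [← ofComplex_zero]
  congr 1
  · apply Complex.ext <;> simp
  · apply Complex.ext <;> simp

theorem contDiff_field (hψ : ContDiff ℝ ∞ ψ) (hφ : ContDiff ℝ ∞ φ) :
    ContDiff ℝ ∞ (field ψ φ) := by
  have e : field ψ φ = fun x => ofComplexL
      (Complex.equivRealProdCLM.symm (pderiv 1 ψ x, -pderiv 0 ψ x), Complex.equivRealProdCLM.symm
      ((pderiv 1 (pderiv 1 φ) x - pderiv 0 (pderiv 0 φ) x) / 2, -pderiv 0 (pderiv 1 φ) x)) := by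
    funext x
    simp only [field, ofComplexL_apply]
    congr 1
  rw [e]
  refine ofComplexL.contDiff.comp (ContDiff.prodMk ?_ ?_)
  · exact Complex.equivRealProdCLM.symm.contDiff.comp
      ((contDiff_pderiv hψ 1).prodMk (contDiff_pderiv hψ 0).neg)
  · refine Complex.equivRealProdCLM.symm.contDiff.comp
      (ContDiff.prodMk ?_ (contDiff_pderiv (contDiff_pderiv hφ 1) 0).neg)
    exact ((contDiff_pderiv (contDiff_pderiv hφ 1) 1).sub
      (contDiff_pderiv (contDiff_pderiv hφ 0) 0)).div_const 2

theorem field_eq_zero {Ω : Set (Space 2)} (hψ : IsTestFunction Ω ψ) (hφ : IsTestFunction Ω φ)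
    {x : Space 2} (hx : x ∉ Ω) : field ψ φ x = 0 := by
  rw [field, (hψ.pderiv 0).eq_zero hx, (hψ.pderiv 1).eq_zero hx,
    ((hφ.pderiv 0).pderiv 0).eq_zero hx, ((hφ.pderiv 1).pderiv 0).eq_zero hx,
    ((hφ.pderiv 1).pderiv 1).eq_zero hx, ← ofComplex_zero]
  congr 1
  · apply Complex.ext <;> simp
  · apply Complex.ext <;> simp

theorem isTestFunction_field {Ω : Set (Space 2)} (hψ : IsTestFunction Ω ψ)
    (hφ : IsTestFunction Ω φ) : IsTestFunction Ω (field ψ φ) := by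
  refine isTestFunction_of_forall_notMem (contDiff_field hψ.1 hφ.1)
    (hψ.2.1.isCompact.union hφ.2.1.isCompact) (Set.union_subset hψ.2.2 hφ.2.2) fun x hx => ?_
  exact field_eq_zero (Ω := tsupport ψ ∪ tsupport φ)
    ⟨hψ.1, hψ.2.1, Set.subset_union_left⟩ ⟨hφ.1, hφ.2.1, Set.subset_union_right⟩ hx

theorem isTestFunction_pressure {Ω : Set (Space 2)} (hφ : IsTestFunction Ω φ) :
    IsTestFunction Ω (pressure φ) := by
  have h0 := (hφ.pderiv 0).pderiv 0
  have h1 := (hφ.pderiv 1).pderiv 1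
  have h := h0.add h1
  refine isTestFunction_of_forall_notMem (h.1.div_const 2) h.2.1.isCompact h.2.2 fun x hx => ?_
  have h' : pderiv 0 (pderiv 0 φ) x + pderiv 1 (pderiv 1 φ) x = 0 :=
    image_eq_zero_of_notMem_tsupport (f := pderiv 0 (pderiv 0 φ) + pderiv 1 (pderiv 1 φ)) hx
  rw [pressure, h', zero_div]

theorem isSubsolution_field (hψ : ContDiff ℝ ∞ ψ) (hφ : ContDiff ℝ ∞ φ) :
    IsSubsolution (field ψ φ) (pressure φ) := by
  have c0 := contDiff_pderiv hφ 0
  have c1 := contDiff_pderiv hφ 1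
  have c00 := contDiff_pderiv c0 0
  have c11 := contDiff_pderiv c1 1
  have e01 := pderiv_comm hφ 0 1
  have hp : pressure φ = (1 / 2 : ℝ) • (pderiv 0 (pderiv 0 φ) + pderiv 1 (pderiv 1 φ)) := by
    funext x; simp [pressure]; ring
  have h00 : (fun y => ((field ψ φ y).snd : Matrix (Fin 2) (Fin 2) ℝ) 0 0) =
      (1 / 2 : ℝ) • (pderiv 1 (pderiv 1 φ) - pderiv 0 (pderiv 0 φ)) := by
    funext y; simp [field, ofComplex_snd]; ring
  have h01 : (fun y => ((field ψ φ y).snd : Matrix (Fin 2) (Fin 2) ℝ) 0 1) =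
      -(pderiv 0 (pderiv 1 φ)) := by
    funext y; simp [field, ofComplex_snd]
  have h10 : (fun y => ((field ψ φ y).snd : Matrix (Fin 2) (Fin 2) ℝ) 1 0) =
      -(pderiv 0 (pderiv 1 φ)) := by
    funext y; simp [field, ofComplex_snd]
  have h11 : (fun y => ((field ψ φ y).snd : Matrix (Fin 2) (Fin 2) ℝ) 1 1) =
      (1 / 2 : ℝ) • (pderiv 0 (pderiv 0 φ) - pderiv 1 (pderiv 1 φ)) := by
    funext y; simp [field, ofComplex_snd]; ring
  constructor
  · intro x
    have h0 : (fun y => (field ψ φ y).fst 0) = pderiv 1 ψ := rfl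
    have h1 : (fun y => (field ψ φ y).fst 1) = -pderiv 0 ψ := rfl
    rw [Fin.sum_univ_two, h0, h1, pderiv_neg, pderiv_comm hψ 0 1]
    simp
  · intro x i
    fin_cases i
    · simp only [Fin.zero_eta, Fin.sum_univ_two]
      rw [h00, h01, hp, pderiv_const_smul, pderiv_const_smul, pderiv_neg, pderiv_sub c11 c00,
        pderiv_add c00 c11, pderiv_comm c1 1 0]
      simp; ring
    · simp only [Fin.mk_one, Fin.sum_univ_two]
      rw [h10, h11, hp, pderiv_const_smul, pderiv_const_smul, pderiv_neg, pderiv_sub c00 c11,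
        pderiv_add c00 c11, pderiv_comm c0 1 0, e01]
      simp; ring

theorem setIntegral_const_add_add {Ω : Set (Space 2)} (hΩ : MeasureTheory.volume Ω ≠ ⊤) (c : ℝ)
    {g h : Space 2 → ℝ} (hg : MeasureTheory.IntegrableOn g Ω)
    (hh : MeasureTheory.IntegrableOn h Ω) :
    ∫ x in Ω, (c + g x + h x) =
      c * (MeasureTheory.volume Ω).toReal + (∫ x in Ω, g x) + ∫ x in Ω, h x := by
  have hc : MeasureTheory.IntegrableOn (fun _ : Space 2 => c) Ω :=
    MeasureTheory.integrableOn_const hΩ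
  have hcg : MeasureTheory.IntegrableOn (fun x => c + g x) Ω := hc.add hg
  rw [MeasureTheory.integral_add hcg hh, MeasureTheory.integral_add hc hg,
    MeasureTheory.setIntegral_const, smul_eq_mul, mul_comm, MeasureTheory.measureReal_def]

/-- Compactly supported fields have mean zero, so the energy of a perturbed constant state splits.
-/
theorem integral_norm_sq_add_field {Ω : Set (Space 2)} (hΩ : MeasurableSet Ω)
    (hb : Bornology.IsBounded Ω) (hψ : IsTestFunction Ω ψ) (hφ : IsTestFunction Ω φ)
    (w : State 2) : ∫ x in Ω, ‖w + field ψ φ x‖ ^ 2 =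
      ‖w‖ ^ 2 * (MeasureTheory.volume Ω).toReal + ∫ x in Ω, ‖field ψ φ x‖ ^ 2 := by
  obtain ⟨z, ζ, rfl⟩ := exists_ofComplex w
  set g : Space 2 → ℝ := fun x => 2 * (z.re * pderiv 1 ψ x - z.im * pderiv 0 ψ x +
    ζ.re / 2 * (pderiv 1 (pderiv 1 φ) x - pderiv 0 (pderiv 0 φ) x) -
    ζ.im * pderiv 0 (pderiv 1 φ) x) with hg
  have hpt (x : Space 2) : ‖ofComplex z ζ + field ψ φ x‖ ^ 2 =
      ‖ofComplex z ζ‖ ^ 2 + g x + ‖field ψ φ x‖ ^ 2 := by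
    simp only [field, ← ofComplex_add, norm_ofComplex_sq, hg, Complex.add_re, Complex.add_im]
    ring
  have hd (k : Space 2 → ℝ) (j : Fin 2) (hk : IsTestFunction Ω k) :
      MeasureTheory.Integrable (pderiv j k) ∧ ∫ x, pderiv j k x = 0 :=
    ⟨(hk.pderiv j).1.continuous.integrable_of_hasCompactSupport (hk.pderiv j).2.1,
      integral_pderiv hk j⟩
  have hadd (k k' : Space 2 → ℝ) (a b : ℝ) (h : MeasureTheory.Integrable k ∧ ∫ x, k x = 0)
      (h' : MeasureTheory.Integrable k' ∧ ∫ x, k' x = 0) :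
      MeasureTheory.Integrable (fun x => a * k x + b * k' x) ∧ ∫ x, (a * k x + b * k' x) = 0 := by
    refine ⟨(h.1.const_mul a).add (h'.1.const_mul b), ?_⟩
    rw [MeasureTheory.integral_add (h.1.const_mul a) (h'.1.const_mul b),
      MeasureTheory.integral_const_mul, MeasureTheory.integral_const_mul, h.2, h'.2]
    simp
  obtain ⟨hgi, hg0⟩ : MeasureTheory.Integrable g ∧ ∫ x, g x = 0 := by
    have h1 := hadd _ _ (2 * z.re) (-(2 * z.im)) (hd _ 1 hψ) (hd _ 0 hψ)
    have h2 := hadd _ _ ζ.re (-ζ.re) (hd _ 1 (hφ.pderiv 1)) (hd _ 0 (hφ.pderiv 0))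
    have h3 := hadd _ _ 1 (-(2 * ζ.im)) (hadd _ _ 1 1 h1 h2) (hd _ 0 (hφ.pderiv 1))
    have e : g = fun x => 1 * (1 * (2 * z.re * pderiv 1 ψ x + -(2 * z.im) * pderiv 0 ψ x) +
        1 * (ζ.re * pderiv 1 (pderiv 1 φ) x + -ζ.re * pderiv 0 (pderiv 0 φ) x)) +
        -(2 * ζ.im) * pderiv 0 (pderiv 1 φ) x := by
      funext x; rw [hg]; ring
    rw [e]
    exact h3
  have hgΩ : ∫ x in Ω, g x = 0 := by
    rw [MeasureTheory.setIntegral_eq_integral_of_forall_compl_eq_zero, hg0]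
    intro x hx
    simp only [hg, (hψ.pderiv 0).eq_zero hx, (hψ.pderiv 1).eq_zero hx,
      ((hφ.pderiv 0).pderiv 0).eq_zero hx, ((hφ.pderiv 1).pderiv 0).eq_zero hx,
      ((hφ.pderiv 1).pderiv 1).eq_zero hx]
    simp
  have hFi : MeasureTheory.IntegrableOn (fun x => ‖field ψ φ x‖ ^ 2) Ω :=
    ((contDiff_field hψ.1 hφ.1).continuous.norm.pow 2).continuousOn.integrableOn_compact
      (Metric.isCompact_of_isClosed_isBounded isClosed_closure hb.closure) |>.mono_set
      subset_closure
  rw [MeasureTheory.setIntegral_congr_fun hΩ fun x _ => hpt x,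
    setIntegral_const_add_add hb.measure_lt_top.ne _ hgi.integrableOn hFi, hgΩ,
    add_zero]

end Field

/-! ### Oscillating profiles and cutoff functions -/

section Profile

/-- The primitive of `p` that vanishes at `-1`. -/
noncomputable def primitive (p : ℝ → ℝ) (y : ℝ) : ℝ := ∫ x in (-1)..y, p x

variable {p : ℝ → ℝ}

theorem hasDerivAt_primitive (hp : Continuous p) (y : ℝ) : HasDerivAt (primitive p) (p y) y :=
  intervalIntegral.integral_hasDerivAt_right (hp.intervalIntegrable _ _)
    (hp.stronglyMeasurableAtFilter _ _) hp.continuousAt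

theorem contDiff_primitive (hp : ContDiff ℝ ∞ p) : ContDiff ℝ ∞ (primitive p) := by
  have h := hasDerivAt_primitive hp.continuous
  refine contDiff_infty_iff_deriv.2 ⟨fun y => (h y).differentiableAt, ?_⟩
  have : deriv (primitive p) = p := funext fun y => (h y).deriv
  rwa [this]

theorem primitive_eq_zero {ρ : ℝ} (hρ : ρ < 1) (hp : Continuous p)
    (h0 : ∀ y, ρ ≤ |y| → p y = 0) (hint : ∫ x in (-1)..1, p x = 0) {y : ℝ} (hy : ρ ≤ |y|) :
    primitive p y = 0 := by
  have key (a b : ℝ) (h : ∀ x ∈ Set.uIcc a b, ρ ≤ |x|) : ∫ x in a..b, p x = 0 := by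
    rw [intervalIntegral.integral_congr (g := fun _ => 0) fun x hx => h0 x (h x hx)]
    simp
  rcases le_total 0 y with hy0 | hy0
  · rw [abs_of_nonneg hy0] at hy
    rw [primitive, ← intervalIntegral.integral_add_adjacent_intervals
      (hp.intervalIntegrable _ _) (hp.intervalIntegrable 1 y), hint, zero_add]
    refine key _ _ fun x hx => ?_
    obtain ⟨h1, -⟩ := hx
    exact (le_inf hρ.le hy).trans (h1.trans (le_abs_self x))
  · rw [abs_of_nonpos hy0] at hy
    refine key _ _ fun x hx => ?_
    obtain ⟨-, h1⟩ := hx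
    have : x ≤ -ρ := h1.trans (sup_le (by linarith) (by linarith))
    exact (le_neg.2 this).trans (neg_le_abs x)

theorem abs_primitive_le {ρ : ℝ} (hρ : ρ < 1) (hp : Continuous p)
    (h0 : ∀ y, ρ ≤ |y| → p y = 0) (hint : ∫ x in (-1)..1, p x = 0) {C : ℝ} (hC : ∀ y, |p y| ≤ C)
    (y : ℝ) : |primitive p y| ≤ 2 * C := by
  have hC0 : 0 ≤ C := (abs_nonneg _).trans (hC 0)
  by_cases hy : ρ ≤ |y|
  · rw [primitive_eq_zero hρ hp h0 hint hy, abs_zero]; positivity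
  · have h1 := intervalIntegral.norm_integral_le_of_norm_le_const (f := p) (a := -1) (b := y)
      (C := C) fun x _ => hC x
    have h2 : |y - -1| ≤ 2 := by
      obtain ⟨h3, h4⟩ := abs_lt.1 ((not_le.1 hy).trans hρ)
      rw [abs_le]; constructor <;> linarith
    calc |primitive p y| ≤ C * |y - -1| := h1
      _ ≤ 2 * C := by nlinarith

theorem primitive_neg (hp : Continuous p) (he : ∀ y, p (-y) = p y)
    (hint : ∫ x in (-1)..1, p x = 0) (y : ℝ) : primitive p (-y) = -primitive p y := by
  have h1 : primitive p (-y) = ∫ x in y..1, p x := by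
    rw [primitive, ← intervalIntegral.integral_comp_neg]
    simp [he]
  have h2 := intervalIntegral.integral_add_adjacent_intervals
      (hp.intervalIntegrable (μ := MeasureTheory.volume) (-1) y) (hp.intervalIntegrable y 1)
  rw [hint] at h2
  rw [h1, primitive]
  linarith

theorem intervalIntegral_eq_zero_of_odd (ho : ∀ y, p (-y) = -p y) :
    ∫ x in (-1)..1, p x = 0 := by
  have h := intervalIntegral.integral_comp_neg (f := p) (a := -1) (b := 1)
  simp only [ho, intervalIntegral.integral_neg, neg_neg] at h
  linarith

/-- The `1`-periodic function that agrees with `P` on `[-1/2, 1/2)`. -/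
noncomputable def periodize (P : ℝ → ℝ) (y : ℝ) : ℝ := P (y - round y)

theorem periodize_eventuallyEq {P : ℝ → ℝ} {ρ : ℝ} (hρ : ρ < 1 / 2)
    (h0 : ∀ y, ρ ≤ |y| → P y = 0) (y₀ : ℝ) :
    periodize P =ᶠ[nhds y₀] fun y => P (y - round y₀) := by
  filter_upwards [Metric.ball_mem_nhds y₀ (sub_pos.2 hρ)] with y hy
  rw [Metric.mem_ball, Real.dist_eq] at hy
  rw [periodize]
  by_cases h : round y = round y₀
  · rw [h]
  have hy1 := abs_sub_round y
  have hy2 := abs_sub_round y₀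
  have hz : (1 : ℝ) ≤ |(round y : ℝ) - round y₀| := by
    have : (1 : ℤ) ≤ |round y - round y₀| := Int.one_le_abs (sub_ne_zero.2 h)
    exact_mod_cast this
  rw [h0, h0]
  · have := abs_sub_abs_le_abs_sub ((round y : ℝ) - round y₀) (round y - y)
    rw [abs_sub_comm (round y : ℝ) y] at this
    have e : (round y : ℝ) - round y₀ - (round y - y) = y - round y₀ := by ring
    rw [e] at this
    linarith
  · have h3 := abs_sub_abs_le_abs_sub ((round y₀ : ℝ) - round y) (round y₀ - y₀)
    rw [abs_sub_comm (round y₀ : ℝ) y₀, abs_sub_comm (round y₀ : ℝ) (round y)] at h3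
    have e : (round y₀ : ℝ) - round y - (round y₀ - y₀) = (y₀ - y) + (y - round y) := by ring
    rw [e] at h3
    have h4 := abs_add_le (y₀ - y) (y - round y)
    rw [abs_sub_comm y₀ y] at h4
    linarith

theorem hasDerivAt_periodize {P P' : ℝ → ℝ} {ρ : ℝ} (hρ : ρ < 1 / 2)
    (h0 : ∀ y, ρ ≤ |y| → P y = 0) (hP : ∀ y, HasDerivAt P (P' y) y) (y : ℝ) :
    HasDerivAt (periodize P) (periodize P' y) y :=
  ((hP (y - round y)).comp_sub_const y _).congr_of_eventuallyEq (periodize_eventuallyEq hρ h0 y)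

theorem contDiff_periodize {P : ℝ → ℝ} {ρ : ℝ} (hρ : ρ < 1 / 2)
    (h0 : ∀ y, ρ ≤ |y| → P y = 0) (hP : ContDiff ℝ ∞ P) : ContDiff ℝ ∞ (periodize P) := by
  refine contDiff_iff_contDiffAt.2 fun y => ?_
  refine ContDiffAt.congr_of_eventuallyEq ?_ (periodize_eventuallyEq hρ h0 y)
  exact (hP.comp (contDiff_id.sub contDiff_const)).contDiffAt

/-- The profile of the plane waves: a smooth periodic `h` with values in `[-t, 1 - t]`, equal to one
of the two end points off a small neighbourhood of the jumps, which has a bounded periodic second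
primitive `H`. The bounds on the primitives do not depend on the width `w` of the plateaus.

It is the periodization of `B (y / t) - t B (y)`, where `B` is an even bump function: the two terms
have the same integral, so that the first primitive is odd and both primitives have compact
support. -/
theorem exists_profile {t w : ℝ} (ht0 : 0 < t) (hw : t / 2 ≤ w) (hw1 : w < 1 / 2) :
    ∃ H h₁ h : ℝ → ℝ, ContDiff ℝ ∞ H ∧ (∀ y, HasDerivAt H (h₁ y) y) ∧
      (∀ y, HasDerivAt h₁ (h y) y) ∧ (∀ y, |H y| ≤ 4) ∧ (∀ y, |h₁ y| ≤ 2) ∧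
      (∀ y, h y ∈ Set.Icc (-t) (1 - t)) ∧ (∀ y : ℝ, |y - round y| < t * w → h y = 1 - t) ∧
      (∀ y : ℝ, t / 2 < |y - round y| → |y - round y| < w → h y = -t) := by
  have hw0 : 0 < w := by linarith
  have ht1 : t < 1 := by linarith
  set B : ContDiffBump (0 : ℝ) := ⟨w, (w + 1 / 2) / 2, hw0, by linarith⟩ with hB
  set ρ : ℝ := (w + 1 / 2) / 2 with hρ
  have hρ1 : ρ < 1 / 2 := by rw [hρ]; linarith
  have hρ2 : ρ < 1 := by linarith
  have hρ0 : 0 < ρ := by rw [hρ]; linarith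
  have B0 (y : ℝ) (hy : ρ ≤ |y|) : B y = 0 :=
    B.zero_of_le_dist (by rw [Real.dist_eq, sub_zero]; exact hy)
  have B1 (y : ℝ) (hy : |y| ≤ w) : B y = 1 :=
    B.one_of_mem_closedBall (by rw [Metric.mem_closedBall, Real.dist_eq, sub_zero]; exact hy)
  have Bs : ContDiff ℝ ∞ B := B.contDiff
  have Be (y : ℝ) : B (-y) = B y := B.neg y
  have habs (y : ℝ) : |y / t| = |y| / t := by rw [abs_div, abs_of_pos ht0]
  set p : ℝ → ℝ := fun y => B (y / t) - t * B y with hp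
  have ps : ContDiff ℝ ∞ p :=
    (Bs.comp (contDiff_id.div_const t)).sub (contDiff_const.mul Bs)
  have pe (y : ℝ) : p (-y) = p y := by simp only [hp, neg_div, Be]
  have p0 (y : ℝ) (hy : ρ ≤ |y|) : p y = 0 := by
    have : ρ ≤ |y / t| := by
      rw [habs, le_div_iff₀ ht0]; nlinarith
    simp only [hp, B0 y hy, B0 _ this]; simp
  have hpi : ∫ x in (-1)..1, p x = 0 := by
    have hsupp : Function.support p ⊆ Set.Ioc (-1) 1 := by
      intro x hx
      have : |x| < ρ := by by_contra! h; exact hx (p0 x h)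
      obtain ⟨h1, h2⟩ := abs_lt.1 this
      constructor <;> linarith
    have Bi : MeasureTheory.Integrable B := B.continuous.integrable_of_hasCompactSupport
      B.hasCompactSupport
    rw [intervalIntegral.integral_eq_integral_of_support_subset hsupp, hp,
      MeasureTheory.integral_sub (Bi.comp_div ht0.ne') (Bi.const_mul t),
      MeasureTheory.Measure.integral_comp_div, MeasureTheory.integral_const_mul, abs_of_pos ht0]
    simp
  have pr (y : ℝ) : p y ∈ Set.Icc (-t) (1 - t) := by
    have b0 : 0 ≤ B y := B.nonneg
    have b1 : B y ≤ 1 := B.le_one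
    have b0' : 0 ≤ B (y / t) := B.nonneg
    have b1' : B (y / t) ≤ 1 := B.le_one
    refine ⟨by simp only [hp]; nlinarith, ?_⟩
    by_cases hy : |y| ≤ w
    · simp only [hp, B1 y hy]; linarith
    · have : ρ ≤ |y / t| := by
        rw [habs, le_div_iff₀ ht0]; push Not at hy; nlinarith
      simp only [hp, B0 _ this]; nlinarith
  have pa (y : ℝ) : |p y| ≤ 1 := by
    obtain ⟨h1, h2⟩ := pr y
    rw [abs_le]; constructor <;> linarith
  set P := primitive p with hP
  have Ps : ContDiff ℝ ∞ P := contDiff_primitive ps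
  have P0 (y : ℝ) (hy : ρ ≤ |y|) : P y = 0 := primitive_eq_zero hρ2 ps.continuous p0 hpi hy
  have Po : ∫ x in (-1)..1, P x = 0 :=
    intervalIntegral_eq_zero_of_odd (primitive_neg ps.continuous pe hpi)
  have Pa (y : ℝ) : |P y| ≤ 2 * 1 := abs_primitive_le hρ2 ps.continuous p0 hpi pa y
  have Q0 (y : ℝ) (hy : ρ ≤ |y|) : primitive P y = 0 :=
    primitive_eq_zero hρ2 Ps.continuous P0 Po hy
  refine ⟨periodize (primitive P), periodize P, periodize p,
    contDiff_periodize hρ1 Q0 (contDiff_primitive Ps),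
    hasDerivAt_periodize hρ1 Q0 (hasDerivAt_primitive Ps.continuous),
    hasDerivAt_periodize hρ1 P0 (hasDerivAt_primitive ps.continuous), fun y => ?_,
    fun y => (Pa _).trans (by norm_num), fun y => pr _, fun y hy => ?_, fun y hy hy' => ?_⟩
  · exact (abs_primitive_le hρ2 Ps.continuous P0 Po Pa _).trans (by norm_num)
  · have h1 : |(y - round y) / t| ≤ w := by
      rw [habs, div_le_iff₀ ht0]; linarith
    have h2 : |y - round y| ≤ w := by nlinarith
    simp only [periodize, hp, B1 _ h1, B1 _ h2]; ring
  · have h1 : ρ ≤ |(y - round y) / t| := by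
      rw [habs, le_div_iff₀ ht0]; nlinarith
    simp only [periodize, hp, B0 _ h1, B1 _ hy'.le]; ring

theorem continuous_abs_sub_round : Continuous fun y : ℝ => |y - round y| := by
  have h : (fun y : ℝ => |y - round y|) = fun y : ℝ => ‖(y : UnitAddCircle)‖ :=
    funext fun y => (UnitAddCircle.norm_eq).symm
  rw [h]
  exact continuous_norm.comp (AddCircle.continuous_mk' 1)

theorem countable_setOf_abs_sub_round_eq (v : ℝ) : {y : ℝ | |y - round y| = v}.Countable := by
  have h : {y : ℝ | |y - round y| = v} ⊆
      Set.range (fun n : ℤ => (n : ℝ) + v) ∪ Set.range (fun n : ℤ => (n : ℝ) - v) := by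
    intro y hy
    rcases eq_or_eq_neg_of_abs_eq hy with h | h
    · exact Or.inl ⟨round y, by simp only; linarith⟩
    · exact Or.inr ⟨round y, by simp only; linarith⟩
  exact ((Set.countable_range _).union (Set.countable_range _)).mono h

end Profile

theorem exists_cutoff {d : ℕ} {Ω C : Set (Space d)} (hΩ : IsOpen Ω) (hC : IsCompact C)
    (hCΩ : C ⊆ Ω) : ∃ χ : Space d → ℝ, IsTestFunction Ω χ ∧ (∀ x, χ x ∈ Set.Icc (0 : ℝ) 1) ∧
      ∃ O, IsOpen O ∧ C ⊆ O ∧ O ⊆ Ω ∧ ∀ x ∈ O, χ x = 1 := by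
  obtain ⟨C', hC', h1, h2⟩ := exists_compact_between hC hΩ hCΩ
  obtain ⟨χ, e1, e2, e3⟩ := exists_contMDiffMap_one_nhds_of_subset_interior (n := ⊤)
    (modelWithCornersSelf ℝ (Space d)) hC.isClosed h1
  obtain ⟨O, hO, hCO, hO1⟩ := eventually_nhdsSet_iff_exists.1 e1
  refine ⟨χ, isTestFunction_of_forall_notMem χ.contMDiff.contDiff hC' h2 e2, e3, O, hO, hCO, ?_,
    hO1⟩
  intro x hx
  by_contra hxΩ
  have := hO1 x hx
  rw [e2 x fun h => hxΩ (h2 h)] at this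
  exact zero_ne_one this

/-! ### Localized plane waves -/

section PlaneWave

variable {η : Space 2} {χ : Space 2 → ℝ}

theorem pderiv_comp_inner {k k' : ℝ → ℝ} (hk : ∀ y, HasDerivAt k (k' y) y) (N : ℝ) (j : Fin 2) :
    pderiv j (fun x => k (N * inner ℝ η x)) = (N * η j) • fun x => k' (N * inner ℝ η x) := by
  funext x
  have h1 : HasFDerivAt (fun x => N * inner ℝ η x) (N • innerSL ℝ η) x :=
    ((innerSL ℝ η).hasFDerivAt (x := x)).const_mul N
  have h2 := (hk (N * inner ℝ η x)).comp_hasFDerivAt x h1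
  rw [pderiv, HasFDerivAt.fderiv (f := fun x => k (N * inner ℝ η x)) h2]
  simp [EuclideanSpace.inner_single_right]
  ring

theorem contDiff_comp_inner {k : ℝ → ℝ} (hk : ContDiff ℝ ∞ k) (N : ℝ) :
    ContDiff ℝ ∞ (fun x => k (N * inner ℝ η x)) :=
  hk.comp (contDiff_const.mul (innerSL ℝ η).contDiff)

theorem pderiv_planeWave {h₁ h : ℝ → ℝ} (hs : ContDiff ℝ ∞ h₁) (hd : ∀ y, HasDerivAt h₁ (h y) y)
    (hχ : ContDiff ℝ ∞ χ) {N : ℝ} (hN : N ≠ 0) (α : ℝ) (j : Fin 2) (x : Space 2) :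
    pderiv j ((α / N) • ((fun x => h₁ (N * inner ℝ η x)) * χ)) x =
      α * η j * (χ x * h (N * inner ℝ η x)) +
        α / N * (h₁ (N * inner ℝ η x) * pderiv j χ x) := by
  rw [pderiv_const_smul, pderiv_mul (contDiff_comp_inner hs N) hχ, pderiv_comp_inner hd]
  simp only [Pi.smul_apply, Pi.add_apply, Pi.mul_apply, smul_eq_mul]
  field_simp
  ring

theorem pderiv_pderiv_planeWave {H h₁ h : ℝ → ℝ} (hs : ContDiff ℝ ∞ H)
    (hs' : ContDiff ℝ ∞ h₁) (hd : ∀ y, HasDerivAt H (h₁ y) y)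
    (hd' : ∀ y, HasDerivAt h₁ (h y) y)
    (hχ : ContDiff ℝ ∞ χ) {N : ℝ} (hN : N ≠ 0) (β : ℝ) (i j : Fin 2) (x : Space 2) :
    pderiv i (pderiv j ((β / N ^ 2) • ((fun x => H (N * inner ℝ η x)) * χ))) x =
      β * (η i * η j) * (χ x * h (N * inner ℝ η x)) +
        (β / N * (h₁ (N * inner ℝ η x) * (η i * pderiv j χ x + η j * pderiv i χ x)) +
        β / N ^ 2 * (H (N * inner ℝ η x) * pderiv i (pderiv j χ) x)) := by
  have c := contDiff_comp_inner (η := η) hs N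
  have c' := contDiff_comp_inner (η := η) hs' N
  have cj := contDiff_pderiv hχ j
  have c₁ : ContDiff ℝ ∞ ((fun x => H (N * inner ℝ η x)) * pderiv j χ) := c.mul cj
  have c₂ : ContDiff ℝ ∞ ((N * η j) • (χ * fun x => h₁ (N * inner ℝ η x))) :=
    contDiff_const.smul (hχ.mul c')
  rw [pderiv_const_smul, pderiv_const_smul, pderiv_mul c hχ, pderiv_comp_inner hd, mul_smul_comm,
    pderiv_add c₁ c₂, pderiv_const_smul, pderiv_mul c cj,
    pderiv_mul hχ c', pderiv_comp_inner hd, pderiv_comp_inner hd']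
  simp only [Pi.smul_apply, Pi.add_apply, Pi.mul_apply, smul_eq_mul]
  field_simp
  ring

theorem norm_ofComplex_le {z ζ : ℂ} {C : ℝ} (h1 : |z.re| ≤ C) (h2 : |z.im| ≤ C) (h3 : |ζ.re| ≤ C)
    (h4 : |ζ.im| ≤ C) : ‖ofComplex z ζ‖ ≤ 2 * C := by
  have hC : 0 ≤ C := (abs_nonneg _).trans h1
  apply abs_le_of_sq_le_sq' _ (by positivity) |>.2
  rw [norm_ofComplex_sq]
  have := sq_le_sq' (abs_le.1 h1).1 (abs_le.1 h1).2
  have := sq_le_sq' (abs_le.1 h2).1 (abs_le.1 h2).2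
  have := sq_le_sq' (abs_le.1 h3).1 (abs_le.1 h3).2
  have := sq_le_sq' (abs_le.1 h4).1 (abs_le.1 h4).2
  nlinarith

theorem exists_forall_abs_le {Ω : Set (Space 2)} {g : Space 2 → ℝ} (hg : IsTestFunction Ω g) :
    ∃ M, ∀ x, |g x| ≤ M := by
  obtain ⟨M, hM⟩ := hg.2.1.exists_bound_of_continuous hg.1.continuous
  exact ⟨M, hM⟩

theorem IsTestFunction.mul_left {Ω : Set (Space 2)} {g : Space 2 → ℝ} (hχ : IsTestFunction Ω χ)
    (hg : ContDiff ℝ ∞ g) (c : ℝ) : IsTestFunction Ω (c • (g * χ)) :=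
  isTestFunction_of_forall_notMem (contDiff_const.smul (hg.mul hχ.1)) hχ.2.1.isCompact hχ.2.2
    fun x hx => by simp [image_eq_zero_of_notMem_tsupport hx]

theorem pderiv_eq_zero_of_eqOn {d : ℕ} {g : Space d → ℝ} {O : Set (Space d)} (hO : IsOpen O)
    {c : ℝ} (h : ∀ x ∈ O, g x = c) (j : Fin d) {x : Space d} (hx : x ∈ O) : pderiv j g x = 0 := by
  have : g =ᶠ[nhds x] fun _ => c := Filter.eventually_of_mem (hO.mem_nhds hx) h
  rw [pderiv, this.fderiv_eq]
  simp

/-- Cutting off plane waves at the level of the potentials produces an error of the order of the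
wave length, and none where the cutoff function is locally constant. -/
theorem exists_localized_planeWave {Ω O : Set (Space 2)} (hχ : IsTestFunction Ω χ) (hO : IsOpen O)
    (hχO : ∀ x ∈ O, χ x = 1) {lam : State 2} {α β : ℝ}
    (hlam : lam = ofComplex ⟨α * η 1, -(α * η 0)⟩
      ⟨β * ((η 1 ^ 2 - η 0 ^ 2) / 2), -(β * (η 0 * η 1))⟩) :
    ∃ C, ∀ N : ℝ, 1 ≤ N → ∀ H h₁ h : ℝ → ℝ, ContDiff ℝ ∞ H → (∀ y, HasDerivAt H (h₁ y) y) →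
      (∀ y, HasDerivAt h₁ (h y) y) → (∀ y, |H y| ≤ 4) → (∀ y, |h₁ y| ≤ 2) →
      ∃ ψ φ : Space 2 → ℝ, IsTestFunction Ω ψ ∧ IsTestFunction Ω φ ∧
        (∀ x, ‖field ψ φ x - (χ x * h (N * inner ℝ η x)) • lam‖ ≤ C / N) ∧
        ∀ x ∈ O, field ψ φ x = h (N * inner ℝ η x) • lam := by
  choose M₁ hM₁ using fun j => exists_forall_abs_le (hχ.pderiv j)
  choose M₂ hM₂ using fun i j => exists_forall_abs_le ((hχ.pderiv j).pderiv i)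
  set A : ℝ := |α| * (2 * (M₁ 0 + M₁ 1)) with hA
  set e : ℝ := |η 0| + |η 1| with he
  set D : ℝ := |β| * (4 * (e * (M₁ 0 + M₁ 1)) + 4 * (M₂ 0 0 + M₂ 0 1 + M₂ 1 1)) with hD
  have M₁0 (j) : 0 ≤ M₁ j := (abs_nonneg _).trans (hM₁ j 0)
  have M₂0 (i j) : 0 ≤ M₂ i j := (abs_nonneg _).trans (hM₂ i j 0)
  have M₁le (j) : M₁ j ≤ M₁ 0 + M₁ 1 := by
    fin_cases j
    · simpa using M₁0 1
    · simpa using M₁0 0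
  have ele (j) : |η j| ≤ e := by
    fin_cases j
    · simp [he]
    · simp [he]
  refine ⟨2 * (A + D), fun N hN H h₁ h hs hd hd' hH hh₁ => ?_⟩
  have hN0 : 0 < N := by linarith
  have hs' : ContDiff ℝ ∞ h₁ := by
    have : deriv H = h₁ := funext fun y => (hd y).deriv
    rw [← this]; exact (contDiff_infty_iff_deriv.1 hs).2
  set ψ : Space 2 → ℝ := (α / N) • ((fun x => h₁ (N * inner ℝ η x)) * χ) with hψ
  set φ : Space 2 → ℝ := (β / N ^ 2) • ((fun x => H (N * inner ℝ η x)) * χ) with hφ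
  have p1 := pderiv_planeWave (η := η) hs' hd' hχ.1 hN0.ne' α
  have p2 := pderiv_pderiv_planeWave (η := η) hs hs' hd hd' hχ.1 hN0.ne' β
  rw [← hψ] at p1
  rw [← hφ] at p2
  set r₁ : Fin 2 → Space 2 → ℝ := fun j x => α / N * (h₁ (N * inner ℝ η x) * pderiv j χ x) with hr₁
  set r₂ : Fin 2 → Fin 2 → Space 2 → ℝ := fun i j x =>
    β / N * (h₁ (N * inner ℝ η x) * (η i * pderiv j χ x + η j * pderiv i χ x)) +
        β / N ^ 2 * (H (N * inner ℝ η x) * pderiv i (pderiv j χ) x) with hr₂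
  have hfield (x : Space 2) : field ψ φ x = (χ x * h (N * inner ℝ η x)) • lam +
      ofComplex ⟨r₁ 1 x, -r₁ 0 x⟩ ⟨(r₂ 1 1 x - r₂ 0 0 x) / 2, -r₂ 0 1 x⟩ := by
    rw [hlam, ← ofComplex_smul, ← ofComplex_add, field, p1, p1, p2, p2, p2]
    congr 1
    · apply Complex.ext
      · simp; ring
      · simp; ring
    · apply Complex.ext
      · simp; ring
      · simp; ring
  have b1 (j x) : |r₁ j x| ≤ A / N := by
    rw [hr₁]
    simp only [abs_mul, abs_div, abs_of_pos hN0]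
    have : |h₁ (N * inner ℝ η x)| * |pderiv j χ x| ≤ 2 * (M₁ 0 + M₁ 1) :=
      mul_le_mul (hh₁ _) ((hM₁ j x).trans (M₁le j)) (abs_nonneg _) (by norm_num)
    rw [hA, div_mul_eq_mul_div]
    gcongr
  have b2 (i j x) (hij : M₂ i j ≤ M₂ 0 0 + M₂ 0 1 + M₂ 1 1) : |r₂ i j x| ≤ D / N := by
    rw [hr₂]
    refine (abs_add_le _ _).trans ?_
    have e1 : |h₁ (N * inner ℝ η x) * (η i * pderiv j χ x + η j * pderiv i χ x)| ≤
        2 * (e * (M₁ 0 + M₁ 1) + e * (M₁ 0 + M₁ 1)) := by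
      rw [abs_mul]
      refine mul_le_mul (hh₁ _) ((abs_add_le _ _).trans (add_le_add ?_ ?_)) (abs_nonneg _)
        (by norm_num)
      · rw [abs_mul]
        exact mul_le_mul (ele i) ((hM₁ j x).trans (M₁le j)) (abs_nonneg _) (by positivity)
      · rw [abs_mul]
        exact mul_le_mul (ele j) ((hM₁ i x).trans (M₁le i)) (abs_nonneg _) (by positivity)
    have e2 : |H (N * inner ℝ η x) * pderiv i (pderiv j χ) x| ≤
        4 * (M₂ 0 0 + M₂ 0 1 + M₂ 1 1) := by
      rw [abs_mul]
      exact mul_le_mul (hH _) ((hM₂ i j x).trans hij) (abs_nonneg _) (by norm_num)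
    have e3 : |β| / N ^ 2 ≤ |β| / N := by
      apply div_le_div_of_nonneg_left (abs_nonneg _) hN0
      nlinarith
    rw [abs_mul, abs_mul (β / N ^ 2), abs_div, abs_div, abs_of_pos hN0, abs_pow, abs_of_pos hN0]
    have hM : 0 ≤ M₂ 0 0 + M₂ 0 1 + M₂ 1 1 := by
      have := M₂0 0 0; have := M₂0 0 1; have := M₂0 1 1; linarith
    calc _ ≤ |β| / N * (2 * (e * (M₁ 0 + M₁ 1) + e * (M₁ 0 + M₁ 1))) +
          |β| / N * (4 * (M₂ 0 0 + M₂ 0 1 + M₂ 1 1)) := by gcongr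
      _ = D / N := by rw [hD]; ring
  have m00 : M₂ 0 0 ≤ M₂ 0 0 + M₂ 0 1 + M₂ 1 1 := by linarith [M₂0 0 1, M₂0 1 1]
  have m01 : M₂ 0 1 ≤ M₂ 0 0 + M₂ 0 1 + M₂ 1 1 := by linarith [M₂0 0 0, M₂0 1 1]
  have m11 : M₂ 1 1 ≤ M₂ 0 0 + M₂ 0 1 + M₂ 1 1 := by linarith [M₂0 0 1, M₂0 0 0]
  refine ⟨ψ, φ, hχ.mul_left (contDiff_comp_inner hs' N) _,
    hχ.mul_left (contDiff_comp_inner hs N) _, fun x => ?_, fun x hx => ?_⟩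
  · rw [hfield, add_sub_cancel_left, mul_div_assoc]
    have hA0 : 0 ≤ A / N := (abs_nonneg _).trans (b1 0 x)
    have hD0 : 0 ≤ D / N := (abs_nonneg _).trans (b2 0 0 x m00)
    rw [add_div]
    refine norm_ofComplex_le ?_ ?_ ?_ ?_
    · exact (b1 1 x).trans (by linarith)
    · simp only [abs_neg]; exact (b1 0 x).trans (by linarith)
    · obtain ⟨h1, h2⟩ := abs_le.1 (b2 1 1 x m11)
      obtain ⟨h3, h4⟩ := abs_le.1 (b2 0 0 x m00)
      rw [abs_le]; constructor <;> simp only <;> linarith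
    · simp only [abs_neg]; exact (b2 0 1 x m01).trans (by linarith)
  · have z1 (j) : pderiv j χ x = 0 := pderiv_eq_zero_of_eqOn hO hχO j hx
    have z2 (i j) : pderiv i (pderiv j χ) x = 0 :=
      pderiv_eq_zero_of_eqOn hO (fun y hy => pderiv_eq_zero_of_eqOn hO hχO j hy) i hx
    have z3 (j) : r₁ j x = 0 := by simp [hr₁, z1]
    have z4 (i j) : r₂ i j x = 0 := by simp [hr₂, z1, z2]
    rw [hfield, hχO x hx, z3, z3, z4, z4, z4, one_mul]
    simp only [neg_zero, sub_zero, zero_div]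
    exact (congrArg _ ofComplex_zero).trans (add_zero _)

end PlaneWave

/-! ### Reachable energies and property (P) -/

open MeasureTheory

/-- Off a null set, a nonconstant linear phase avoids a given countable set. -/
theorem volume_setOf_inner_mem_eq_zero {η : Space 2} (hη : η ≠ 0) {N : ℝ} (hN : N ≠ 0) {Z : Set ℝ}
    (hZ : Z.Countable) : volume {x : Space 2 | N * inner ℝ η x ∈ Z} = 0 := by
  set L : Space 2 →ₗ[ℝ] ℝ := N • (innerSL ℝ η : Space 2 →ₗ[ℝ] ℝ) with hL
  have hLa (x : Space 2) : L x = N * inner ℝ η x := rfl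
  have hsurj : Function.Surjective L := by
    intro y
    have h0 : inner ℝ η η ≠ 0 := inner_self_ne_zero.2 hη
    refine ⟨(y / (N * inner ℝ η η)) • η, ?_⟩
    rw [hLa, inner_smul_right]
    field_simp
  have h := (ae_comp_linearMap_mem_iff L (volume : Measure (Space 2)) (volume : Measure ℝ) hsurj
    (s := Zᶜ) hZ.measurableSet.compl).2 (by
      rw [ae_iff]; simpa using hZ.measure_zero volume)
  rw [ae_iff] at h
  simpa [hLa] using h

theorem exists_isCompact_lt_volume {d : ℕ} {Ω : Set (Space d)} (hΩ : IsOpen Ω)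
    (hb : Bornology.IsBounded Ω) {c : ℝ} (hc : 0 ≤ c) (h : c < (volume Ω).toReal) :
    ∃ C ⊆ Ω, IsCompact C ∧ c < (volume C).toReal := by
  have h' : ENNReal.ofReal c < volume Ω :=
    (ENNReal.ofReal_lt_iff_lt_toReal hc hb.measure_lt_top.ne).2 h
  obtain ⟨C, hC, hCc, hlt⟩ := hΩ.exists_lt_isCompact h'
  exact ⟨C, hC, hCc, (ENNReal.ofReal_lt_iff_lt_toReal hc hCc.measure_lt_top.ne).1 hlt⟩

/-- The constant state `w` can be perturbed within `U`, by fields with compactly supported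
potentials in any bounded open set, so that the mean energy is at least `m`. -/
def Reaches (U : Set (State 2)) (w : State 2) (m : ℝ) : Prop :=
  ∀ Ω : Set (Space 2), IsOpen Ω → Bornology.IsBounded Ω →
    ∃ ψ φ : Space 2 → ℝ, IsTestFunction Ω ψ ∧ IsTestFunction Ω φ ∧
      (∀ x, w + field ψ φ x ∈ U) ∧
      m * (volume Ω).toReal ≤ ∫ x in Ω, ‖w + field ψ φ x‖ ^ 2

theorem reaches_of_le {U : Set (State 2)} {w : State 2} {m : ℝ} (hw : w ∈ U) (hm : m ≤ ‖w‖ ^ 2) :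
    Reaches U w m := by
  intro Ω _ _
  refine ⟨0, 0, isTestFunction_zero, isTestFunction_zero, fun x => ?_, ?_⟩
  · rw [field_zero]; simpa using hw
  · rw [field_zero]
    simp only [Pi.zero_apply, add_zero]
    rw [setIntegral_const, smul_eq_mul, mul_comm, measureReal_def]
    gcongr

theorem integrableOn_norm_sq_add_field {ψ φ : Space 2 → ℝ} (hψ : ContDiff ℝ ∞ ψ)
    (hφ : ContDiff ℝ ∞ φ) (w : State 2) {Ω : Set (Space 2)} (hb : Bornology.IsBounded Ω) :
    IntegrableOn (fun x => ‖w + field ψ φ x‖ ^ 2) Ω :=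
  have hc : Continuous fun x => ‖w + field ψ φ x‖ ^ 2 :=
    (continuous_const.add (contDiff_field hψ hφ).continuous).norm.pow 2
  (hc.continuousOn.integrableOn_compact
    (Metric.isCompact_of_isClosed_isBounded isClosed_closure hb.closure)).mono_set subset_closure

/-- The mean energies that can be reached from `ξ` and `ξ'` can also be reached, up to an
arbitrarily small loss, from the points between them. A plane wave with profile `h` oscillates
between the two states: it takes exactly the values `ξ` and `ξ'` on two open sets that cover almost
all of the domain, and there the perturbations of `ξ` and `ξ'` are inserted.

The order of the choices matters. The wave number `N` depends on the cutoff function and on the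
distance of the segment to the complement of `U`; the width of the plateaus depends on `N`. -/
theorem reaches_combo {U : Set (State 2)} (hU : IsOpen U) {ξ ξ' : State 2}
    (hξ : ξ - ξ' ∈ waveCone 2) (hseg : ∀ s ∈ Set.Icc (0 : ℝ) 1, s • ξ + (1 - s) • ξ' ∈ U)
    {m m' : ℝ} (hm : m < m') (h : Reaches U ξ m') (h' : Reaches U ξ' m') {t : ℝ}
    (ht : t ∈ Set.Ioo (0 : ℝ) 1) : Reaches U (t • ξ + (1 - t) • ξ') m := by
  obtain ⟨ht0, ht1⟩ := ht
  have htU : t • ξ + (1 - t) • ξ' ∈ U := hseg t ⟨ht0.le, ht1.le⟩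
  rcases le_or_gt m 0 with hm0 | hm0
  · exact reaches_of_le htU (hm0.trans (by positivity))
  intro Ω hΩ hb
  have hm0' : 0 < m' := hm0.trans hm
  rcases (ENNReal.toReal_nonneg (a := volume Ω)).eq_or_lt with hv | hv
  · obtain ⟨ψ, φ, h1, h2, h3, -⟩ := reaches_of_le htU le_rfl Ω hΩ hb
    refine ⟨ψ, φ, h1, h2, h3, ?_⟩
    rw [← hv, mul_zero]
    positivity
  set v := (volume Ω).toReal with hvdef
  have hc0 : 0 ≤ m / m' * v := by positivity
  have hcv : m / m' * v < v := by
    have : m / m' < 1 := (div_lt_one hm0').2 hm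
    nlinarith
  obtain ⟨C₀, hC₀Ω, hC₀, hC₀v⟩ := exists_isCompact_lt_volume hΩ hb hc0 hcv
  obtain ⟨χ, hχ, hχ01, O, hO, hC₀O, hOΩ, hχO⟩ := exists_cutoff hΩ hC₀ hC₀Ω
  obtain ⟨η, α, β, hη, hlam⟩ := exists_of_mem_waveCone hξ
  obtain ⟨C, hC⟩ := exists_localized_planeWave (η := η) hχ hO hχO hlam
  -- a uniform neighbourhood of the segment in `U`
  have hS : IsCompact ((fun s : ℝ => s • ξ + (1 - s) • ξ') '' Set.Icc 0 1) :=
    isCompact_Icc.image (by fun_prop)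
  obtain ⟨δ, hδ, hδU⟩ := hS.exists_thickening_subset_open hU (by
    rintro _ ⟨s, hs, rfl⟩; exact hseg s hs)
  obtain ⟨N, hN1, hNC⟩ : ∃ N : ℝ, 1 ≤ N ∧ C / N < δ := by
    refine ⟨max 1 (|C| / δ + 1), le_max_left _ _, ?_⟩
    have h1 : |C| / δ + 1 ≤ max 1 (|C| / δ + 1) := le_max_right _ _
    have h2 : 0 < max 1 (|C| / δ + 1) := lt_of_lt_of_le one_pos (le_max_left _ _)
    rw [div_lt_iff₀ h2]
    have h3 : |C| = δ * (|C| / δ) := by field_simp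
    nlinarith [le_abs_self C]
  have hN0 : N ≠ 0 := by linarith
  set g : Space 2 → ℝ := fun x => |N * inner ℝ η x - round (N * inner ℝ η x)| with hg
  have hgc : Continuous g := by
    have h1 : Continuous fun x : Space 2 => N * inner ℝ η x :=
      continuous_const.mul (innerSL ℝ η).continuous
    exact continuous_abs_sub_round.comp h1
  have hg2 (x) : g x ≤ 1 / 2 := abs_sub_round _
  -- the jumps of the profile lie on a null set of hyperplanes
  set O' : Set (Space 2) := O ∩ {x | g x ≠ t / 2 ∧ g x ≠ 1 / 2} with hO'
  have hO'o : IsOpen O' := hO.inter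
    ((isOpen_ne_fun hgc continuous_const).inter (isOpen_ne_fun hgc continuous_const))
  have hbO : Bornology.IsBounded O := hb.subset hOΩ
  have hO'v : m / m' * v < (volume O').toReal := by
    refine hC₀v.trans_le (ENNReal.toReal_mono
      (hbO.subset Set.inter_subset_left).measure_lt_top.ne ?_)
    have hnull : volume {x : Space 2 | N * inner ℝ η x ∈
        ({y : ℝ | |y - round y| = t / 2} ∪ {y : ℝ | |y - round y| = 1 / 2})} = 0 :=
      volume_setOf_inner_mem_eq_zero hη hN0
        ((countable_setOf_abs_sub_round_eq _).union (countable_setOf_abs_sub_round_eq _))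
    have hcover : C₀ ⊆ O' ∪ {x : Space 2 | N * inner ℝ η x ∈
        ({y : ℝ | |y - round y| = t / 2} ∪ {y : ℝ | |y - round y| = 1 / 2})} := by
      intro x hx
      by_cases h1 : g x = t / 2
      · exact Or.inr (Or.inl h1)
      by_cases h2 : g x = 1 / 2
      · exact Or.inr (Or.inr h2)
      exact Or.inl ⟨hC₀O hx, h1, h2⟩
    calc volume C₀ ≤ _ := measure_mono hcover
      _ ≤ _ := measure_union_le _ _
      _ = volume O' := by rw [hnull, add_zero]
  obtain ⟨C₁, hC₁O, hC₁, hC₁v⟩ := exists_isCompact_lt_volume hO'o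
    (hbO.subset Set.inter_subset_left) hc0 hO'v
  have hC₁ne : C₁.Nonempty := by
    by_contra hne
    rw [Set.not_nonempty_iff_eq_empty.1 hne] at hC₁v
    simp only [measure_empty, ENNReal.toReal_zero] at hC₁v
    linarith
  obtain ⟨x₀, hx₀, hmin⟩ := hC₁.exists_isMinOn hC₁ne
    (f := fun x => min |g x - t / 2| (1 / 2 - g x)) (by fun_prop)
  set κ := min |g x₀ - t / 2| (1 / 2 - g x₀) with hκ
  have hκ0 : 0 < κ := by
    obtain ⟨-, h1, h2⟩ := hC₁O hx₀
    exact lt_min (abs_pos.2 (sub_ne_zero.2 h1)) (sub_pos.2 (lt_of_le_of_ne (hg2 x₀) h2))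
  obtain ⟨H, h₁, k, Hs, hd, hd', hHb, hhb, hk, hk1, hk2⟩ := exists_profile (w := max (1 / 2 - κ / 2)
    (t / 2)) ht0 (le_max_right _ _) (max_lt (by linarith) (by linarith))
  set w := max (1 / 2 - κ / 2) (t / 2) with hw
  have hw1 : 1 / 2 - κ / 2 ≤ w := le_max_left _ _
  have hw2 : t / 2 ≤ w := le_max_right _ _
  have hw3 : w < 1 / 2 := max_lt (by linarith) (by linarith)
  obtain ⟨ψ₀, φ₀, hψ₀, hφ₀, herr, hexact⟩ := hC N hN1 H h₁ k Hs hd hd' hHb hhb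
  set Ω₁ : Set (Space 2) := O ∩ {x | g x < t * w} with hΩ₁
  set Ω₂ : Set (Space 2) := O ∩ {x | t / 2 < g x ∧ g x < w} with hΩ₂
  have hΩ₁o : IsOpen Ω₁ := hO.inter (isOpen_lt hgc continuous_const)
  have hΩ₂o : IsOpen Ω₂ := hO.inter
    ((isOpen_lt continuous_const hgc).inter (isOpen_lt hgc continuous_const))
  have hΩ₁Ω : Ω₁ ⊆ Ω := Set.inter_subset_left.trans hOΩ
  have hΩ₂Ω : Ω₂ ⊆ Ω := Set.inter_subset_left.trans hOΩ
  have hdisj : Disjoint Ω₁ Ω₂ := by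
    rw [Set.disjoint_left]
    rintro x ⟨-, h1⟩ ⟨-, h2, -⟩
    simp only [Set.mem_ofPred_eq] at h1 h2
    nlinarith
  have hcover : C₁ ⊆ Ω₁ ∪ Ω₂ := by
    intro x hx
    have h1 : κ ≤ min |g x - t / 2| (1 / 2 - g x) := hmin hx
    obtain ⟨h2, h3⟩ := le_min_iff.1 h1
    have hxO : x ∈ O := (hC₁O hx).1
    rcases le_abs.1 h2 with h4 | h4
    · refine Or.inr ⟨hxO, ?_, ?_⟩
      · linarith
      · linarith
    · refine Or.inl ⟨hxO, ?_⟩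
      change g x < t * w
      nlinarith
  have hb₁ := hb.subset hΩ₁Ω
  have hb₂ := hb.subset hΩ₂Ω
  obtain ⟨ψ₁, φ₁, hψ₁, hφ₁, hU₁, hE₁⟩ := h Ω₁ hΩ₁o hb₁
  obtain ⟨ψ₂, φ₂, hψ₂, hφ₂, hU₂, hE₂⟩ := h' Ω₂ hΩ₂o hb₂
  have hψ := (hψ₀.add (hψ₁.mono hΩ₁Ω)).add (hψ₂.mono hΩ₂Ω)
  have hφ := (hφ₀.add (hφ₁.mono hΩ₁Ω)).add (hφ₂.mono hΩ₂Ω)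
  have hsum (x : Space 2) : field (ψ₀ + ψ₁ + ψ₂) (φ₀ + φ₁ + φ₂) x =
      field ψ₀ φ₀ x + field ψ₁ φ₁ x + field ψ₂ φ₂ x := by
    rw [field_add (hψ₀.add (hψ₁.mono hΩ₁Ω)).1 (hφ₀.add (hφ₁.mono hΩ₁Ω)).1 hψ₂.1 hφ₂.1,
      field_add hψ₀.1 hφ₀.1 hψ₁.1 hφ₁.1]
    rfl
  have hval₁ (x) (hx : x ∈ Ω₁) : t • ξ + (1 - t) • ξ' + field (ψ₀ + ψ₁ + ψ₂) (φ₀ + φ₁ + φ₂) x =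
      ξ + field ψ₁ φ₁ x := by
    rw [hsum, hexact x hx.1, hk1 _ hx.2, field_eq_zero hψ₂ hφ₂ (Set.disjoint_left.1 hdisj hx)]
    module
  have hval₂ (x) (hx : x ∈ Ω₂) : t • ξ + (1 - t) • ξ' + field (ψ₀ + ψ₁ + ψ₂) (φ₀ + φ₁ + φ₂) x =
      ξ' + field ψ₂ φ₂ x := by
    rw [hsum, hexact x hx.1, hk2 _ hx.2.1 hx.2.2,
      field_eq_zero hψ₁ hφ₁ (Set.disjoint_right.1 hdisj hx)]
    module
  refine ⟨_, _, hψ, hφ, fun x => ?_, ?_⟩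
  · by_cases hx₁ : x ∈ Ω₁
    · rw [hval₁ x hx₁]; exact hU₁ x
    by_cases hx₂ : x ∈ Ω₂
    · rw [hval₂ x hx₂]; exact hU₂ x
    rw [hsum, field_eq_zero hψ₁ hφ₁ hx₁, field_eq_zero hψ₂ hφ₂ hx₂, add_zero, add_zero]
    apply hδU
    rw [Metric.mem_thickening_iff]
    set s := χ x * k (N * inner ℝ η x) with hs
    obtain ⟨c0, c1⟩ := hχ01 x
    obtain ⟨k0, k1⟩ := hk (N * inner ℝ η x)
    refine ⟨_, ⟨t + s, ⟨by rw [hs]; nlinarith, by rw [hs]; nlinarith⟩, rfl⟩, ?_⟩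
    rw [dist_eq_norm]
    refine lt_of_le_of_lt (le_of_eq_of_le ?_ (herr x)) hNC
    congr 1
    module
  · have hint := integrableOn_norm_sq_add_field hψ.1 hφ.1 (t • ξ + (1 - t) • ξ') hb
    have hvol : m * v ≤ m' * (volume Ω₁).toReal + m' * (volume Ω₂).toReal := by
      have h1 : (volume C₁).toReal ≤ (volume Ω₁).toReal + (volume Ω₂).toReal := by
        rw [← ENNReal.toReal_add hb₁.measure_lt_top.ne hb₂.measure_lt_top.ne]
        exact ENNReal.toReal_mono (ENNReal.add_lt_top.2 ⟨hb₁.measure_lt_top,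
          hb₂.measure_lt_top⟩).ne ((measure_mono hcover).trans (measure_union_le _ _))
      have h2 : m * v = m' * (m / m' * v) := by field_simp
      rw [h2, ← mul_add]
      gcongr
      exact hC₁v.le.trans h1
    refine hvol.trans ((add_le_add hE₁ hE₂).trans ?_)
    have e₁ := setIntegral_congr_fun (μ := volume) hΩ₁o.measurableSet
      fun x hx => congrArg (‖·‖ ^ 2) (hval₁ x hx)
    have e₂ := setIntegral_congr_fun (μ := volume) hΩ₂o.measurableSet
      fun x hx => congrArg (‖·‖ ^ 2) (hval₂ x hx)
    rw [← e₁, ← e₂,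
      ← setIntegral_union hdisj hΩ₂o.measurableSet (hint.mono_set hΩ₁Ω) (hint.mono_set hΩ₂Ω)]
    exact setIntegral_mono_set hint (ae_of_all _ fun x => by positivity)
      (Set.union_subset hΩ₁Ω hΩ₂Ω).eventuallyLE

/-- The full energy gap up to the sphere containing `K_r` is available at every state of `U_r`. The
vertices of slightly smaller sets `K_{r'}` lie in `U_r`, and the states reaching the energy of these
vertices form a set that is stable under lamination. -/
theorem reaches_of_mem_U {r : ℝ} (hr : 0 < r) {w : State 2} (hw : w ∈ U r) {m : ℝ}
    (hm : m < r + r ^ 2 / 4) : Reaches (U r) w m := by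
  have hlam (M : ℝ) : LamConvex {w | w ∈ U r ∧ ∀ m < M, Reaches (U r) w m} := by
    rintro ξ ⟨hξ, hξM⟩ ξ' ⟨hξ', hξM'⟩ hcone t ht
    have hseg := lamConvex_lcHull (rotV r) ξ hξ ξ' hξ' hcone
    refine ⟨hseg t ht, fun m hm => ?_⟩
    rcases ht.1.eq_or_lt with rfl | ht0
    · rw [show (0 : ℝ) • ξ + (1 - 0 : ℝ) • ξ' = ξ' by module]
      exact hξM' m hm
    rcases ht.2.eq_or_lt with rfl | ht1
    · rw [show (1 : ℝ) • ξ + (1 - 1 : ℝ) • ξ' = ξ by module]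
      exact hξM m hm
    obtain ⟨m', hm1, hm2⟩ := exists_between hm
    exact reaches_combo (isOpen_U hr) hcone hseg hm1 (hξM m' hm2) (hξM' m' hm2) ⟨ht0, ht1⟩
  suffices hsub : rotV r ⊆ {w | w ∈ U r ∧ ∀ m < r + r ^ 2 / 4, Reaches (U r) w m} from
    (lcHull_subset hsub (hlam _) hw).2 m hm
  intro w hw
  refine ⟨subset_lcHull _ hw, fun m hm => ?_⟩
  obtain ⟨z, c, θ, ⟨hf, hcr⟩, hc0, -, rfl⟩ := hw
  simp only at hf hcr
  obtain ⟨r', hr'0, hr'r, hf', hcr', hm'⟩ : ∃ r' : ℝ, 0 < r' ∧ r' < r ∧ f r' z c < 1 ∧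
      |c| < r' / 2 ∧ m < r' + r' ^ 2 / 4 := by
    obtain ⟨c1, c2⟩ := abs_lt.1 hcr
    have hfc : ContinuousAt (fun s => f s z c) r := by
      unfold f
      have h1 : r / 2 + c ≠ 0 := by linarith
      have h2 : r / 2 - c ≠ 0 := by linarith
      fun_prop (disch := assumption)
    have e1 : ∀ᶠ s in nhds r, f s z c < 1 := hfc.eventually_lt_const hf
    have e2 : ∀ᶠ s in nhds r, |c| < s / 2 :=
      (by fun_prop : ContinuousAt (fun s : ℝ => s / 2) r).eventually_const_lt hcr
    have e3 : ∀ᶠ s in nhds r, m < s + s ^ 2 / 4 :=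
      (by fun_prop : ContinuousAt (fun s : ℝ => s + s ^ 2 / 4) r).eventually_const_lt hm
    have e4 : ∀ᶠ s in nhdsWithin r (Set.Iio r), 0 < s ∧ s < r ∧ f s z c < 1 ∧
        |c| < s / 2 ∧ m < s + s ^ 2 / 4 := by
      filter_upwards [nhdsWithin_le_nhds (lt_mem_nhds hr), self_mem_nhdsWithin,
        nhdsWithin_le_nhds e1, nhdsWithin_le_nhds e2, nhdsWithin_le_nhds e3] with s a b c d e
      exact ⟨a, b, c, d, e⟩
    exact e4.exists
  have hK : K 2 r' ⊆ {w | w ∈ U r ∧ ∀ m < r' + r' ^ 2 / 4, Reaches (U r) w m} := by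
    intro y hy
    have hyU := K_subset_U hr'0.le hr'r hy
    exact ⟨hyU, fun m hm => reaches_of_le hyU (by rw [norm_sq_of_mem_K hy]; exact hm.le)⟩
  refine (rotV_subset (hlam _) hr'0 hK ⟨z, c, θ, ⟨hf', hcr'⟩, hc0, hcr', rfl⟩).2 m hm'

theorem volume_cube : volume (cube 2) = 1 := by
  have h : cube 2 = (MeasurableEquiv.toLp 2 (Fin 2 → ℝ)).symm ⁻¹'
      (Set.univ.pi fun _ => Set.Ioo (0 : ℝ) 1) := by
    ext x
    simp [cube]
  rw [h, (EuclideanSpace.volume_preserving_symm_measurableEquiv_toLp (Fin 2)).measure_preimage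
    (MeasurableSet.univ_pi fun _ => measurableSet_Ioo).nullMeasurableSet, volume_pi_pi]
  simp

theorem isOpen_cube (d : ℕ) : IsOpen (cube d) := by
  have h : cube d = ⋂ i, {x : Space d | x i ∈ Set.Ioo (0 : ℝ) 1} := by
    ext x; simp [cube]
  rw [h]
  exact isOpen_iInter_of_finite fun i =>
    isOpen_Ioo.preimage (EuclideanSpace.proj (𝕜 := ℝ) i).continuous

theorem isBounded_cube (d : ℕ) : Bornology.IsBounded (cube d) := by
  refine (Metric.isBounded_closedBall (x := (0 : Space d)) (r := √(∑ _ : Fin d, (1 : ℝ)))).subset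
    fun x hx => ?_
  rw [mem_closedBall_zero_iff, EuclideanSpace.norm_eq]
  refine Real.sqrt_le_sqrt (Finset.sum_le_sum fun i _ => ?_)
  obtain ⟨h0, h1⟩ := hx i
  rw [Real.norm_of_nonneg h0.le]
  nlinarith

theorem propertyP_U : PropertyP U := by
  refine ⟨fun s => s ^ 2 / 2, by fun_prop, ?_, by simp, ?_⟩
  · intro a ha b hb hab
    have ha' : 0 ≤ a := ha
    simp only
    nlinarith
  intro r hr w hw
  set D := Metric.infDist w (K 2 r) with hD
  have hdist : D ^ 2 ≤ r + r ^ 2 / 4 - ‖w‖ ^ 2 := infDist_sq_le (U_subset_convexHull hr hw)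
  obtain ⟨ψ, φ, hψ, hφ, hU, hE⟩ : ∃ ψ φ : Space 2 → ℝ, IsTestFunction (cube 2) ψ ∧
      IsTestFunction (cube 2) φ ∧ (∀ x, w + field ψ φ x ∈ U r) ∧
      (‖w‖ ^ 2 + D ^ 2 / 2) * (volume (cube 2)).toReal ≤
        ∫ x in cube 2, ‖w + field ψ φ x‖ ^ 2 := by
    rcases (Metric.infDist_nonneg : 0 ≤ D).eq_or_lt with h0 | h0
    · refine reaches_of_le hw ?_ _ (isOpen_cube 2) (isBounded_cube 2)
      have : D = 0 := h0.symm
      rw [this]; simp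
    · exact reaches_of_mem_U hr hw (by nlinarith) _ (isOpen_cube 2) (isBounded_cube 2)
  refine ⟨field ψ φ, pressure φ, isTestFunction_field hψ hφ, isTestFunction_pressure hφ,
    isSubsolution_field hψ.1 hφ.1, fun x _ => hU x, ?_⟩
  rw [integral_norm_sq_add_field (isOpen_cube 2).measurableSet (isBounded_cube 2) hψ hφ,
    volume_cube] at hE
  simp only [ENNReal.toReal_one, mul_one] at hE
  simp only
  linarith

end StationaryEuler

theorem mainTheorem4 :
    (∀ r : ℝ, 0 < r →
      IsOpen (StationaryEuler.U r) ∧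
        StationaryEuler.U r ⊆ convexHull ℝ (StationaryEuler.K 2 r)) ∧
      StationaryEuler.PropertyP StationaryEuler.U ∧
      StationaryEuler.PropertyStar StationaryEuler.U :=
  ⟨fun _ hr => ⟨StationaryEuler.isOpen_U hr, StationaryEuler.U_subset_convexHull hr⟩,
    StationaryEuler.propertyP_U, fun _ _ hr h => StationaryEuler.K_subset_U hr h⟩
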